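/- Fix $\pi_1\in(0,1)$, $r\ge 0$, $\omega\ge 0$ with $\omega\ne r^2$. For each $n$ let $c\in\{-1,1\}^n$ have its first $\lfloor n\pi_1\rfloor$ entries equal to $1$ (community 1) and the other entries equal to $-1$ (community 2). Let $A$ be the adjacency matrix of a random simple undirected graph on $n$ nodes from the two-community stochastic block model: $A$ is symmetric with zero diagonal and its entries above the diagonal are independent Bernoulli variables, with parameter $\lambda_n/n$ for two nodes of community 1, $\omega\lambda_n/n$ for two nodes of community 2, and $r\lambda_n/n$ for nodes of different communities. Assume $\log n=O(\lambda_n)$ as $n\to\infty$. Write $\|\cdot\|$ for the Euclidean norm of vectors and the spectral norm of matrices. Two leading eigenvectors of a symmetric matrix are two orthonormal eigenvectors belonging to its two eigenvalues of largest absolute value, and $U_{\mathbb{E}[A]}$ is a $2\times n$ matrix whose rows are two leading eigenvectors of $\mathbb{E}[A]$. For a $2\times n$ matrix $U_A$ with rows $u_1^T,u_2^T$ put $$\hat c=\mathrm{sign}\big((u_1^T\mathbf 1)\,u_2-(u_2^T\mathbf 1)\,u_1\big)\in\{-1,1\}^n,$$ where $\mathrm{sign}(0)$ may be chosen as either $1$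 or $-1$, separately for each entry. For every $\delta\in(0,1)$ there is a constant $M>0$ depending only on $r,\omega,\pi_1,\delta$ such that for every such sequence $(\lambda_n)$ and all sufficiently large $n$, with probability at least $1-n^{-\delta}$ the following hold simultaneously. 1. For every $2\times n$ real matrix $U_A$, every $U_{\mathbb{E}[A]}$ and every $\hat c$ as above, $$\frac1n\min\big(\|\hat c-c\|^2,\|\hat c+c\|^2\big)\le M\,\|U_A-U_{\mathbb{E}[A]}\|^2 .$$ If the rows of $U_A$ are orthonormal, the same holds with $\|U_A-U_{\mathbb{E}[A]}\|$ replaced by $\|U_A^TU_A-U_{\mathbb{E}[A]}^TU_{\mathbb{E}[A]}\|$, the distance between the orthogonal projections onto the two row spaces. 2. If the rows of $U_A$ are two leading eigenvectors of $A$, then the fraction of nodes mis-clustered by $\hat c$, up to swapping the names of the two communities, is at most $M/\lambda_n$. -/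

import Mathlib

open Filter MeasureTheory ProbabilityTheory Matrix
/- On matrices, the norm bars denote the spectral norm (operator norm for the Euclidean norms). -/
open scoped Matrix.Norms.L2Operator

noncomputable section

namespace TwoBlock

/-- The true communities: the first `n π₁` nodes (rounded down) form community `0`,
the remaining nodes form community `1`. -/
def community (π₁ : ℝ) (n : ℕ) (i : Fin n) : Fin 2 :=
  if (i : ℕ) < ⌊π₁ * n⌋₊ then 0 else 1

/-- The true label vector `c` with entries in `{1, -1}`. -/
def trueLabel (π₁ : ℝ) (n : ℕ) (i : Fin n) : ℝ :=
  if community π₁ n i = 0 then 1 else -1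

/-- The two-by-two matrix of edge probabilities within and between the communities. -/
def blockProb (r w lam : ℝ) (n : ℕ) : Matrix (Fin 2) (Fin 2) ℝ :=
  (lam / n) • !![1, r; r, w]

/-- `A` is the adjacency matrix of a random simple undirected graph on `n` nodes drawn from the
stochastic block model: the entries above the diagonal are independent Bernoulli variables whose
parameters depend on the communities only. -/
structure IsSBM {Ω : Type*} [MeasurableSpace Ω] (μ : Measure Ω) (π₁ r w lam : ℝ) (n : ℕ)
    (A : Ω → Matrix (Fin n) (Fin n) ℝ) : Prop where
  measurable : ∀ i j, Measurable fun x => A x i j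
  zero_or_one : ∀ x i j, A x i j = 0 ∨ A x i j = 1
  symm : ∀ x, (A x).IsSymm
  diag : ∀ x i, A x i i = 0
  indep : iIndepFun (fun (e : {e : Fin n × Fin n // e.1 < e.2}) (x : Ω) => A x e.1.1 e.1.2) μ
  prob : ∀ i j, i < j →
    μ.real {x | A x i j = 1} = blockProb r w lam n (community π₁ n i) (community π₁ n j)

/-- The entrywise expectation of a random matrix. -/
def expMatrix {Ω : Type*} [MeasurableSpace Ω] (μ : Measure Ω) {n : ℕ}
    (A : Ω → Matrix (Fin n) (Fin n) ℝ) : Matrix (Fin n) (Fin n) ℝ :=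
  Matrix.of fun i j => ∫ x, A x i j ∂μ

/-- The rows of `U` are two leading eigenvectors of the symmetric matrix `B`: they are
orthonormal eigenvectors, and no eigenvector orthogonal to both of them has an eigenvalue of larger
absolute value. The order of the two rows and their signs are not prescribed. -/
structure IsLeadingPair {n : ℕ} (B : Matrix (Fin n) (Fin n) ℝ) (U : Matrix (Fin 2) (Fin n) ℝ) :
    Prop where
  orthonormal : U * Uᵀ = 1
  leading : ∃ ρ : Fin 2 → ℝ, (∀ k, B *ᵥ U k = ρ k • U k) ∧
    ∀ (ν : ℝ) (v : Fin n → ℝ), v ≠ 0 → B *ᵥ v = ν • v → (∀ k, U k ⬝ᵥ v = 0) → ∀ k, |ν| ≤ |ρ k|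

/-- The vector `(u₁ᵀ 1) u₂ - (u₂ᵀ 1) u₁`, where `u₁`, `u₂` are the rows of `U`. -/
def score {n : ℕ} (U : Matrix (Fin 2) (Fin n) ℝ) : Fin n → ℝ :=
  (U 0 ⬝ᵥ 1) • U 1 - (U 1 ⬝ᵥ 1) • U 0

/-- `e` is the label vector `sign ((u₁ᵀ 1) u₂ - (u₂ᵀ 1) u₁)` in `{-1, 1}ⁿ`; where the argument of
the sign vanishes, either label may be chosen. -/
def IsEstimate {n : ℕ} (U : Matrix (Fin 2) (Fin n) ℝ) (e : Fin n → ℝ) : Prop :=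
  ∀ i, (e i = 1 ∨ e i = -1) ∧ (0 < score U i → e i = 1) ∧ (score U i < 0 → e i = -1)

/-- The squared Euclidean distance between the label vectors `e` and `c`, where `c` is taken
up to a global change of sign (that is, up to swapping the names of the two communities). -/
def sqDist {n : ℕ} (e c : Fin n → ℝ) : ℝ :=
  min (‖WithLp.toLp 2 (e - c)‖ ^ 2) (‖WithLp.toLp 2 (e + c)‖ ^ 2)

/-- The fraction of nodes that are mis-clustered by `e` when the true labels are `c`, up to
swapping the names of the two communities. -/
def misFraction {n : ℕ} (e c : Fin n → ℝ) : ℝ :=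
  (min ({i | e i ≠ c i} : Set (Fin n)).ncard ({i | e i ≠ -c i} : Set (Fin n)).ncard : ℕ) / (n : ℝ)

end TwoBlock

end

/-! Split the adjacency matrix as `signal` plus an error: the signal is constant on pairs of
communities, and the error consists of the centred `noise` and the diagonal removed from the
expectation, which has norm at most 1. The signal maps into the plane of vectors constant on
communities. On that plane it is bounded below by a multiple of the degree parameter, since the
two-by-two connectivity matrix has determinant `w - r ^ 2 ≠ 0` and both communities have linear size
(`le_vnorm_signal_mulVec`).

The first claim is deterministic. For large degree, the leading eigenvectors of the expectation are
exactly block vectors. For two orthonormal block rows the score has opposite signs on the two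
communities and entries bounded away from zero, so each mislabelled node costs a fixed amount in the
perturbation of the score (`sqDist_le_of_close`). The score sees the rows only through their span,
up to scale; accordingly the projection version replaces the given orthonormal rows by their images
in the block plane.

The second claim does not need the sharp order of the noise norm. It suffices that the norm is a
small fraction of the degree and that the noise acts on block vectors with the square root of the
degree. An eigenvector `v` then differs from the block vector `ρ⁻¹ S v`, where `S` is the signal, by
`ρ⁻¹ F v`, where `F` is the error. The crude bound makes this difference at most 1/2, and splitting
`F v` along the block part and the rest improves it to order one over the square root of the degree
(`exists_blockVec_close`). Squaring gives the rate.

The action on block vectors is a second moment computation (`measure_noise_mulVec_sq_le`). The crude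
norm bound (`eventually_measure_noise_norm_le`) is a moment comparison: the expected trace of the
`2p`-th power is a sum over closed walks, and grouping walks by their coincidence pattern bounds it
by `n / R` times the same average for a dense random matrix of size `R ≥ L + p`, where `L / n`
dominates the edge probabilities. For that dense matrix a coarse grid of test vectors and
sub-Gaussian tails show that the norm is `o(R)`; with `p` about `log n`, which is at most of the
order of the degree, Markov's inequality finishes. -/

namespace TwoBlock

/-! ### Closed walks and their weights -/

/-- The product of the entries of `M` along a walk. -/
def walkProd {α : Type*} {k : ℕ} (M : Matrix α α ℝ) (u : Fin (k + 1) → α) : ℝ :=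
  ∏ i : Fin k, M (u i.castSucc) (u i.succ)

theorem pow_apply_eq_sum_walkProd {α : Type*} [Fintype α] [DecidableEq α] (M : Matrix α α ℝ)
    (k : ℕ) (a b : α) :
    (M ^ k) a b = ∑ u : Fin (k + 1) → α, if u 0 = a ∧ u (Fin.last k) = b then walkProd M u else 0 := by
  induction k generalizing a with
  | zero =>
    rw [← (Equiv.funUnique (Fin 1) α).symm.sum_comp]
    simp only [pow_zero, Matrix.one_apply, walkProd, Finset.univ_eq_empty, Finset.prod_empty]
    rw [Finset.sum_eq_single a]
    · simp
    · intro c _ hc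
      simp [hc]
    · simp
  | succ k ih =>
    have hr : ∑ u : Fin (k + 2) → α,
        (if u 0 = a ∧ u (Fin.last (k + 1)) = b then walkProd M u else 0) =
        ∑ u : Fin (k + 1) → α, if u (Fin.last k) = b then M a (u 0) * walkProd M u else 0 := by
      rw [← (Fin.consEquiv (fun _ : Fin (k + 2) => α)).sum_comp, Fintype.sum_prod_type,
        Finset.sum_comm]
      refine Finset.sum_congr rfl fun u _ => ?_
      rw [Finset.sum_eq_single a]
      · simp [walkProd, Fin.prod_univ_succ, Fin.consEquiv, ← Fin.succ_last]
      · intro c _ hc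
        simp [Fin.consEquiv, hc]
      · simp
    rw [hr, pow_succ', Matrix.mul_apply]
    simp_rw [ih, Finset.mul_sum]
    rw [Finset.sum_comm]
    refine Finset.sum_congr rfl fun u _ => ?_
    rw [Finset.sum_eq_single (u 0)]
    · simp
    · intro c _ hc
      simp [hc.symm]
    · simp

theorem trace_pow_eq_sum_walkProd {α : Type*} [Fintype α] [DecidableEq α] (M : Matrix α α ℝ)
    (k : ℕ) :
    (M ^ k).trace = ∑ u : Fin (k + 1) → α, if u 0 = u (Fin.last k) then walkProd M u else 0 := by
  simp_rw [Matrix.trace, Matrix.diag, pow_apply_eq_sum_walkProd]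
  rw [Finset.sum_comm]
  refine Finset.sum_congr rfl fun u _ => ?_
  rw [Finset.sum_eq_single (u 0)]
  · simp [eq_comm]
  · intro c _ hc
    simp [hc.symm]
  · simp

/-- The unordered pair of nodes visited by the `i`-th step of a walk. -/
def step {α : Type*} {k : ℕ} (u : Fin (k + 1) → α) (i : Fin k) : Sym2 α :=
  s(u i.castSucc, u i.succ)

/-- The `k`-th moment of the uniform distribution on `{2, -1, -1}`. -/
noncomputable def moment3 (k : ℕ) : ℝ := (2 ^ k + 2 * (-1) ^ k) / 3

theorem moment3_one : moment3 1 = 0 := by norm_num [moment3]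

/-- This is why the comparison law is the skewed one on `{2, -1, -1}`: its mean vanishes, as for the
noise, while every higher moment, odd ones included, is at least 1. A symmetric law would lose the
odd moments, which do not vanish for centred Bernoulli variables. -/
theorem one_le_moment3 {k : ℕ} (hk : 2 ≤ k) : 1 ≤ moment3 k := by
  unfold moment3
  obtain ⟨j, rfl⟩ := Nat.exists_eq_add_of_le hk
  rcases Nat.eq_zero_or_pos j with rfl | hj
  · norm_num
  · have h1 : (2 : ℝ) ^ 1 ≤ 2 ^ j := pow_le_pow_right₀ (by norm_num) hj
    have h2 : -1 ≤ (-1 : ℝ) ^ (2 + j) := by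
      rcases neg_one_pow_eq_or ℝ (2 + j) with h | h <;> rw [h]; norm_num
    rw [pow_add]
    norm_num at *
    linarith

theorem moment3_nonneg {k : ℕ} (hk : 1 ≤ k) : 0 ≤ moment3 k := by
  rcases hk.eq_or_lt with rfl | h
  · rw [moment3_one]
  · exact zero_le_one.trans (one_le_moment3 h)

/-- The product over the edges of a walk of the moments of order the multiplicity of the edge;
zero if the walk has a loop. -/
noncomputable def walkWeight {α : Type*} [DecidableEq α] {k : ℕ} (u : Fin (k + 1) → α) : ℝ :=
  if ∃ i : Fin k, (step u i).IsDiag then 0 else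
    ∏ e ∈ Finset.univ.image (step u), moment3 (Finset.univ.filter fun i => step u i = e).card

theorem walkWeight_nonneg {α : Type*} [DecidableEq α] {k : ℕ} (u : Fin (k + 1) → α) :
    0 ≤ walkWeight u := by
  unfold walkWeight
  split_ifs
  · exact le_rfl
  · refine Finset.prod_nonneg fun e he => moment3_nonneg ?_
    obtain ⟨i, -, hi⟩ := Finset.mem_image.1 he
    exact Finset.card_pos.2 ⟨i, by simp [hi]⟩

theorem step_comp {α β : Type*} {k : ℕ} (u : Fin (k + 1) → α) (f : α → β) (i : Fin k) :
    step (f ∘ u) i = Sym2.map f (step u i) := rfl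

/-- The weight sees only which positions of the walk coincide, so it can be read off the kernel of
the walk. -/
theorem walkWeight_comp {α β : Type*} [DecidableEq α] [DecidableEq β] {k : ℕ}
    (u : Fin (k + 1) → α) {f : α → β} (hf : f.Injective) :
    walkWeight (f ∘ u) = walkWeight u := by
  have hd : ∀ i, (step (f ∘ u) i).IsDiag ↔ (step u i).IsDiag := fun i => by
    simp [step, hf.eq_iff]
  unfold walkWeight
  simp_rw [hd]
  congr 1
  have : (Finset.univ.image (step (f ∘ u))) = (Finset.univ.image (step u)).image (Sym2.map f) := by
    rw [Finset.image_image]; rfl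
  rw [this, Finset.prod_image fun x _ y _ h => Sym2.map.injective hf h]
  refine Finset.prod_congr rfl fun e _ => ?_
  congr 2
  ext i
  simp [step_comp, (Sym2.map.injective hf).eq_iff]

/-- Whenever the last step reaches a new node it also uses a new edge; this is the bound on vertices
by edges plus one in a connected graph. -/
theorem card_image_le_card_image_step_add_one {α : Type*} [DecidableEq α] {k : ℕ}
    (u : Fin (k + 1) → α) :
    (Finset.univ.image u).card ≤ (Finset.univ.image (step u)).card + 1 := by
  induction k with
  | zero =>
    simp
  | succ k ih =>
    have h := ih (fun i => u i.castSucc)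
    have e1 : Finset.univ.image u =
        insert (u (Fin.last _)) (Finset.univ.image fun i : Fin (k + 1) => u i.castSucc) := by
      ext a
      simp only [Finset.mem_image, Finset.mem_univ, true_and, Finset.mem_insert]
      rw [Fin.exists_fin_succ']
      tauto
    have e2 : Finset.univ.image (step u) =
        insert (step u (Fin.last _)) (Finset.univ.image (step fun i : Fin (k + 1) => u i.castSucc)) := by
      ext a
      simp only [Finset.mem_image, Finset.mem_univ, true_and, Finset.mem_insert]
      rw [Fin.exists_fin_succ']
      simp only [step, Fin.succ_castSucc]
      tauto
    by_cases hu : u (Fin.last _) ∈ Finset.univ.image fun i : Fin (k + 1) => u i.castSucc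
    · rw [e1, e2, Finset.insert_eq_of_mem hu]
      exact h.trans (by gcongr; exact Finset.subset_insert _ _)
    · have hs : step u (Fin.last _) ∉ Finset.univ.image (step fun i : Fin (k + 1) => u i.castSucc) := by
        intro hmem
        obtain ⟨i, -, hi⟩ := Finset.mem_image.1 hmem
        have : u (Fin.last (k + 1)) ∈ step u (Fin.last k) := by simp [step]
        rw [← hi] at this
        simp only [step, Sym2.mem_iff] at this
        rcases this with h' | h' <;> exact hu (Finset.mem_image.2 ⟨_, Finset.mem_univ _, h'.symm⟩)
      rw [e1, e2, Finset.card_insert_of_notMem hu, Finset.card_insert_of_notMem hs]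
      omega

/-- An edge traversed once contributes `moment3 1 = 0`, so each edge takes at least two of the `2 *
p` steps. -/
theorem card_image_step_le_of_walkWeight_ne_zero {α : Type*} [DecidableEq α] {p : ℕ}
    (u : Fin (2 * p + 1) → α) (hu : walkWeight u ≠ 0) :
    (Finset.univ.image (step u)).card ≤ p := by
  unfold walkWeight at hu
  split_ifs at hu with hd
  · exact absurd rfl hu
  rw [Finset.prod_ne_zero_iff] at hu
  have h2 : ∀ e ∈ Finset.univ.image (step u),
      2 ≤ (Finset.univ.filter fun i => step u i = e).card := by
    intro e he
    have h0 := hu e he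
    obtain ⟨i, -, hi⟩ := Finset.mem_image.1 he
    have h1 : 0 < (Finset.univ.filter fun i => step u i = e).card :=
      Finset.card_pos.2 ⟨i, by simp [hi]⟩
    by_contra! hlt
    have : (Finset.univ.filter fun i => step u i = e).card = 1 := by omega
    rw [this, moment3_one] at h0
    exact h0 rfl
  have := Finset.card_nsmul_le_sum _ _ _ h2
  rw [← Finset.card_eq_sum_card_image] at this
  simp at this
  omega

/-! ### Comparison of walk sums through coincidence patterns -/

/-- The number of functions with a given kernel. -/
theorem card_filter_ker_eq {ι α : Type*} [Fintype ι] [Fintype α] [DecidableEq ι] [DecidableEq α]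
    (s : Setoid ι) [Fintype (Quotient s)] [DecidablePred fun u : ι → α => Setoid.ker u = s] :
    (Finset.univ.filter fun u : ι → α => Setoid.ker u = s).card =
      (Fintype.card α).descFactorial (Fintype.card (Quotient s)) := by
  classical
  rw [← Fintype.card_embedding_eq, ← Finset.card_univ]
  symm
  refine Finset.card_bij (fun φ _ i => φ (Quotient.mk s i)) ?_ ?_ ?_
  · intro φ _
    simp only [Finset.mem_filter, Finset.mem_univ, true_and]
    ext i j
    simp [Setoid.ker_def, φ.injective.eq_iff, Quotient.eq]
  · intro φ _ ψ _ h
    ext x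
    induction x using Quotient.inductionOn with
    | h i => exact congrFun h i
  · intro u hu
    simp only [Finset.mem_filter, Finset.mem_univ, true_and] at hu
    subst hu
    refine ⟨⟨Quotient.lift u fun a b h => h, ?_⟩, Finset.mem_univ _, rfl⟩
    intro x y
    induction x using Quotient.inductionOn
    induction y using Quotient.inductionOn
    intro h
    exact Quotient.sound h

/-- Comparison of sums over walks on `n` nodes and over walks on `R` nodes, through the classes of
walks with the same kernel. -/
theorem sum_walkWeight_le {n R p : ℕ} {L : ℝ} (hL : 0 ≤ L) (hn : 0 < n) (hR : L + p ≤ R)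
    (hR0 : 0 < R) :
    ∑ u : Fin (2 * p + 1) → Fin n, (if u 0 = u (Fin.last _) then
        (L / n) ^ ((Finset.univ.image u).card - 1) * walkWeight u else 0) ≤
      (n / R : ℝ) * ∑ u : Fin (2 * p + 1) → Fin R,
        (if u 0 = u (Fin.last _) then walkWeight u else 0) := by
  classical
  have : Finite (Setoid (Fin (2 * p + 1))) :=
    Finite.of_injective (fun s : Setoid (Fin (2 * p + 1)) => fun i j => s i j)
      fun s t h => Setoid.ext fun a b => (congrFun (congrFun h a) b).to_iff
  have := Fintype.ofFinite (Setoid (Fin (2 * p + 1)))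
  -- Closedness and weight of a walk depend on its kernel alone. Both sums thus become sums over
  -- equivalence relations, weighted by falling factorials.
  let G : Setoid (Fin (2 * p + 1)) → ℝ := fun s =>
    if s 0 (Fin.last _) then walkWeight (fun i => (Quotient.mk s i : Quotient s)) else 0
  have key : ∀ (N : ℕ) (u : Fin (2 * p + 1) → Fin N),
      (if u 0 = u (Fin.last _) then walkWeight u else 0) = G (Setoid.ker u) := by
    intro N u
    simp only [G, Setoid.ker_def]
    congr 1
    exact walkWeight_comp (fun i => (Quotient.mk (Setoid.ker u) i)) (Setoid.kerLift_injective u)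
  have hc : ∀ (N : ℕ) (u : Fin (2 * p + 1) → Fin N),
      (Finset.univ.image u).card = Fintype.card (Quotient (Setoid.ker u)) := by
    intro N u
    have e1 : Finset.univ.image u = (Finset.univ : Finset (Quotient (Setoid.ker u))).image
        (Setoid.kerLift u) := by
      ext a
      simp only [Finset.mem_image, Finset.mem_univ, true_and]
      constructor
      · rintro ⟨i, rfl⟩
        exact ⟨Quotient.mk _ i, rfl⟩
      · rintro ⟨x, rfl⟩
        induction x using Quotient.inductionOn with
        | h i => exact ⟨i, rfl⟩
    rw [e1, Finset.card_image_of_injective _ (Setoid.kerLift_injective u), Finset.card_univ]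
  have hG0 : ∀ s, 0 ≤ G s := fun s => by
    simp only [G]; split_ifs; exacts [walkWeight_nonneg _, le_rfl]
  have lhs : ∀ (N : ℕ) (H : ℕ → ℝ), ∑ u : Fin (2 * p + 1) → Fin N,
      H (Finset.univ.image u).card * (if u 0 = u (Fin.last _) then walkWeight u else 0) =
      ∑ s : Setoid (Fin (2 * p + 1)), (N.descFactorial (Fintype.card (Quotient s)) : ℝ) *
        (H (Fintype.card (Quotient s)) * G s) := by
    intro N H
    rw [← Finset.sum_fiberwise (s := Finset.univ) (g := fun u : Fin (2 * p + 1) → Fin N =>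
      Setoid.ker u)]
    refine Finset.sum_congr rfl fun s _ => ?_
    rw [Finset.sum_congr rfl (g := fun _ => H (Fintype.card (Quotient s)) * G s)]
    · rw [Finset.sum_const, card_filter_ker_eq, Fintype.card_fin, nsmul_eq_mul]
    · intro u hu
      have hu : Setoid.ker u = s := by simpa using hu
      subst hu
      rw [key, hc]
  have h1 := lhs n fun c => (L / n) ^ (c - 1)
  have h2 := lhs R fun _ => 1
  simp only [one_mul] at h2
  rw [h2]
  simp only [mul_ite, mul_zero] at h1
  rw [h1, Finset.mul_sum]
  refine Finset.sum_le_sum fun s _ => ?_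
  by_cases hs : G s = 0
  · simp [hs]
  have hle : Fintype.card (Quotient s) ≤ p + 1 := by
    simp only [G] at hs
    split_ifs at hs with h0
    · have a := card_image_step_le_of_walkWeight_ne_zero _ hs
      have b := card_image_le_card_image_step_add_one fun i => (Quotient.mk s i : Quotient s)
      rw [Finset.image_univ_of_surjective Quotient.mk_surjective, Finset.card_univ] at b
      omega
    · exact absurd rfl hs
  have hpos : 1 ≤ Fintype.card (Quotient s) := Fintype.card_pos_iff.2 ⟨Quotient.mk s 0⟩
  obtain ⟨c, hcc⟩ := Nat.exists_eq_add_of_le' hpos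
  rw [hcc] at hle ⊢
  simp only [add_tsub_cancel_right]
  rw [← mul_assoc, ← mul_assoc]
  refine mul_le_mul_of_nonneg_right ?_ (hG0 s)
  have hn' : (0 : ℝ) < n := by exact_mod_cast hn
  have hR' : (0 : ℝ) < R := by exact_mod_cast hR0
  obtain ⟨R', rfl⟩ := Nat.exists_eq_add_of_le' hR0
  -- A pattern with `c + 1` classes contributes at most `n ^ (c + 1) * (L / n) ^ c = n * L ^ c` on
  -- the left. On `R` nodes it occurs `R (R - 1) ... (R - c)` times, which is at least `R * L ^ c`,
  -- because `c ≤ p` and `R - p ≥ L`.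
  have a1 : ((n.descFactorial (c + 1) : ℕ) : ℝ) ≤ (n : ℝ) ^ (c + 1) := by
    exact_mod_cast Nat.descFactorial_le_pow n (c + 1)
  have a2 : L ^ c ≤ (R'.descFactorial c : ℝ) := by
    have hcp : (c : ℝ) ≤ p := by exact_mod_cast (by omega : c ≤ p)
    calc L ^ c ≤ ((R' + 1 - c : ℕ) : ℝ) ^ c := by
          gcongr
          have : ((R' + 1 : ℕ) : ℝ) - (c : ℕ) ≤ ((R' + 1 - c : ℕ) : ℝ) := by
            rw [sub_le_iff_le_add]; exact_mod_cast (by omega)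
          linarith
      _ ≤ _ := by exact_mod_cast Nat.pow_sub_le_descFactorial R' c
  rw [Nat.succ_descFactorial_succ]
  calc ((n.descFactorial (c + 1) : ℕ) : ℝ) * (L / n) ^ c ≤ (n : ℝ) ^ (c + 1) * (L / n) ^ c := by
        gcongr
    _ = n * L ^ c := by rw [div_pow, pow_succ]; field_simp
    _ ≤ n * (R'.descFactorial c : ℝ) := by gcongr
    _ = _ := by push_cast at hR' ⊢; field_simp

/-- Equal factors are collected into powers before independence is applied; indices that do not
occur give factor 1. -/
theorem integral_prod_eq_prod_image {Ω ι J : Type*} [MeasurableSpace Ω] {μ : Measure Ω}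
    [Fintype ι] [DecidableEq ι] [Fintype J] {ξ : ι → Ω → ℝ} (hξ : iIndepFun ξ μ)
    (hm : ∀ i, Measurable (ξ i)) (z : J → ι) :
    ∫ x, ∏ j, ξ (z j) x ∂μ = ∏ i ∈ Finset.univ.image z,
      ∫ x, ξ i x ^ (Finset.univ.filter fun j => z j = i).card ∂μ := by
  have := hξ.isProbabilityMeasure
  have hk : ∀ i ∉ Finset.univ.image z, (Finset.univ.filter fun j => z j = i).card = 0 := by
    intro i hi
    rw [Finset.card_eq_zero, Finset.filter_eq_empty_iff]
    intro j _ hj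
    exact hi (Finset.mem_image.2 ⟨j, Finset.mem_univ _, hj⟩)
  have h1 : ∀ x, ∏ j, ξ (z j) x = ∏ i, ξ i x ^ (Finset.univ.filter fun j => z j = i).card := by
    intro x
    rw [Finset.prod_comp (fun i => ξ i x) z]
    refine Finset.prod_subset (Finset.subset_univ _) fun i _ hi => ?_
    rw [hk i hi, pow_zero]
  simp_rw [h1]
  rw [hξ.integral_fun_prod_comp
    (f := fun i t => t ^ (Finset.univ.filter fun j => z j = i).card)
    (fun i => (hm i).aemeasurable) (fun i => by fun_prop)]
  symm
  refine Finset.prod_subset (Finset.subset_univ _) fun i _ hi => ?_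
  rw [hk i hi]
  simp

/-! ### Moments of the noise -/

/-- The centred adjacency matrix. -/
noncomputable def noise {Ω : Type*} [MeasurableSpace Ω] (μ : Measure Ω) {n : ℕ}
    (A : Ω → Matrix (Fin n) (Fin n) ℝ) (x : Ω) : Matrix (Fin n) (Fin n) ℝ :=
  A x - expMatrix μ A

namespace IsSBM

variable {Ω : Type*} [MeasurableSpace Ω] {μ : Measure Ω} [IsProbabilityMeasure μ]
  {π₁ r w lam : ℝ} {n : ℕ} {A : Ω → Matrix (Fin n) (Fin n) ℝ}

theorem entry_integrable (h : IsSBM μ π₁ r w lam n A) (i j : Fin n) :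
    Integrable (fun x => A x i j) μ := by
  refine Integrable.of_bound (h.measurable i j).aestronglyMeasurable 1 (ae_of_all _ fun x => ?_)
  rcases h.zero_or_one x i j with h | h <;> simp [h]

theorem integral_entry (h : IsSBM μ π₁ r w lam n A) (i j : Fin n) :
    ∫ x, A x i j ∂μ = μ.real {x | A x i j = 1} := by
  have hm : MeasurableSet {x | A x i j = 1} := h.measurable i j (measurableSet_singleton 1)
  rw [← integral_indicator_one hm]
  congr 1
  ext x
  rcases h.zero_or_one x i j with h | h <;> simp [Set.indicator, h]

theorem expMatrix_apply_mem (h : IsSBM μ π₁ r w lam n A) (i j : Fin n) :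
    0 ≤ expMatrix μ A i j ∧ expMatrix μ A i j ≤ 1 := by
  simp only [expMatrix, Matrix.of_apply, h.integral_entry]
  exact ⟨measureReal_nonneg, measureReal_le_one⟩

theorem expMatrix_isSymm (h : IsSBM μ π₁ r w lam n A) : (expMatrix μ A).IsSymm := by
  ext i j
  simp only [expMatrix, Matrix.transpose_apply, Matrix.of_apply]
  congr 1
  ext x
  exact (h.symm x).apply i j

theorem expMatrix_diag (h : IsSBM μ π₁ r w lam n A) (i : Fin n) : expMatrix μ A i i = 0 := by
  simp [expMatrix, h.diag]

theorem blockProb_comm (r w lam : ℝ) (n : ℕ) (a b : Fin 2) :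
    blockProb r w lam n a b = blockProb r w lam n b a := by
  fin_cases a <;> fin_cases b <;> simp [blockProb]

theorem expMatrix_of_ne (h : IsSBM μ π₁ r w lam n A) {i j : Fin n} (hij : i ≠ j) :
    expMatrix μ A i j = blockProb r w lam n (community π₁ n i) (community π₁ n j) := by
  rcases lt_or_gt_of_ne hij with hlt | hlt
  · rw [← h.prob i j hlt, ← h.integral_entry]; rfl
  · rw [← h.expMatrix_isSymm.apply, blockProb_comm, ← h.prob j i hlt, ← h.integral_entry]; rfl

theorem noise_isSymm (h : IsSBM μ π₁ r w lam n A) (x : Ω) : (noise μ A x).IsSymm :=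
  (h.symm x).sub h.expMatrix_isSymm

theorem noise_diag (h : IsSBM μ π₁ r w lam n A) (x : Ω) (i : Fin n) : noise μ A x i i = 0 := by
  simp [noise, h.diag, h.expMatrix_diag]

theorem noise_measurable (h : IsSBM μ π₁ r w lam n A) (i j : Fin n) :
    Measurable fun x => noise μ A x i j :=
  (h.measurable i j).sub_const _

theorem abs_noise_le_one (h : IsSBM μ π₁ r w lam n A) (x : Ω) (i j : Fin n) :
    |noise μ A x i j| ≤ 1 := by
  obtain ⟨h0, h1⟩ := h.expMatrix_apply_mem i j
  rw [abs_le]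
  simp only [noise, Matrix.sub_apply]
  rcases h.zero_or_one x i j with h | h <;> rw [h] <;> constructor <;> linarith

theorem integral_noise (h : IsSBM μ π₁ r w lam n A) (i j : Fin n) :
    ∫ x, noise μ A x i j ∂μ = 0 := by
  simp only [noise, Matrix.sub_apply]
  rw [integral_sub (h.entry_integrable i j) (integrable_const _)]
  simp [expMatrix]

theorem integral_noise_sq_le (h : IsSBM μ π₁ r w lam n A) (i j : Fin n) :
    ∫ x, noise μ A x i j ^ 2 ∂μ ≤ expMatrix μ A i j := by
  obtain ⟨h0, h1⟩ := h.expMatrix_apply_mem i j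
  have e : ∀ x, noise μ A x i j ^ 2 =
      A x i j * (1 - 2 * expMatrix μ A i j) + expMatrix μ A i j ^ 2 := by
    intro x
    simp only [noise, Matrix.sub_apply]
    rcases h.zero_or_one x i j with h | h <;> rw [h] <;> ring
  simp_rw [e]
  rw [integral_add ((h.entry_integrable i j).mul_const _) (integrable_const _),
    integral_mul_const]
  have : ∫ x, A x i j ∂μ = expMatrix μ A i j := rfl
  rw [this]
  simp
  nlinarith

/-- Entries of the noise are at most 1 in absolute value, so every power from the second on is
dominated by the square, and a Bernoulli variance is at most its mean. -/
theorem abs_integral_noise_pow_le_exp (h : IsSBM μ π₁ r w lam n A) (i j : Fin n) {k : ℕ}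
    (hk : 1 ≤ k) : |∫ x, noise μ A x i j ^ k ∂μ| ≤ expMatrix μ A i j := by
  rcases hk.eq_or_lt with rfl | hk
  · simpa [h.integral_noise] using (h.expMatrix_apply_mem i j).1
  calc |∫ x, noise μ A x i j ^ k ∂μ| ≤ ∫ x, |noise μ A x i j ^ k| ∂μ := abs_integral_le_integral_abs
    _ ≤ ∫ x, noise μ A x i j ^ 2 ∂μ := by
      refine integral_mono_of_nonneg (ae_of_all _ fun x => abs_nonneg _) ?_ (ae_of_all _ fun x => ?_)
      · refine Integrable.of_bound ((h.noise_measurable i j).pow_const 2).aestronglyMeasurable 1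
          (ae_of_all _ fun x => ?_)
        rw [norm_pow]
        exact pow_le_one₀ (norm_nonneg _) (h.abs_noise_le_one x i j)
      · simp only
        rw [abs_pow, ← sq_abs]
        exact pow_le_pow_of_le_one (abs_nonneg _) (h.abs_noise_le_one x i j) hk
    _ ≤ expMatrix μ A i j := h.integral_noise_sq_le i j

theorem abs_integral_noise_pow_le (h : IsSBM μ π₁ r w lam n A) (i j : Fin n) {k : ℕ} (hk : 1 ≤ k) :
    |∫ x, noise μ A x i j ^ k ∂μ| ≤ expMatrix μ A i j * moment3 k := by
  rcases hk.eq_or_lt with rfl | hk'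
  · simp [h.integral_noise, moment3_one]
  exact (h.abs_integral_noise_pow_le_exp i j hk).trans
    (le_mul_of_one_le_right (h.expMatrix_apply_mem i j).1 (one_le_moment3 hk'))

theorem noise_eq_inf_sup (h : IsSBM μ π₁ r w lam n A) (x : Ω) (i j : Fin n) :
    noise μ A x i j = noise μ A x s(i, j).inf s(i, j).sup := by
  simp only [Sym2.inf_mk, Sym2.sup_mk]
  rcases le_total i j with hij | hij
  · rw [inf_eq_left.2 hij, sup_eq_right.2 hij]
  · rw [inf_eq_right.2 hij, sup_eq_left.2 hij, (h.noise_isSymm x).apply]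

theorem inf_lt_sup_of_not_isDiag {α : Type*} [LinearOrder α] {e : Sym2 α} (he : ¬ e.IsDiag) :
    e.inf < e.sup := by
  induction e using Sym2.ind with
  | _ a b => simpa [Sym2.mk_isDiag_iff, eq_comm] using he

/-- Independence of the centred entries: expectation of products. -/
theorem integral_prod_noise {J : Type*} [Fintype J] (h : IsSBM μ π₁ r w lam n A)
    (z : J → Sym2 (Fin n)) (hz : ∀ j, ¬ (z j).IsDiag) :
    ∫ x, ∏ j, noise μ A x (z j).inf (z j).sup ∂μ = ∏ e ∈ Finset.univ.image z,
      ∫ x, noise μ A x e.inf e.sup ^ (Finset.univ.filter fun j => z j = e).card ∂μ := by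
  let ξ : {e : Sym2 (Fin n) // ¬ e.IsDiag} → Ω → ℝ := fun e x => noise μ A x e.1.inf e.1.sup
  have hξ : iIndepFun ξ μ := by
    have h1 := h.indep.precomp (g := fun e : {e : Sym2 (Fin n) // ¬ e.IsDiag} =>
      (⟨(e.1.inf, e.1.sup), inf_lt_sup_of_not_isDiag e.2⟩ : {e : Fin n × Fin n // e.1 < e.2})) (by
        intro e f hef
        simp only [Subtype.mk.injEq, Prod.mk.injEq] at hef
        exact Subtype.ext (Sym2.inf_eq_inf_and_sup_eq_sup.1 hef))
    exact h1.comp (fun e t => t - expMatrix μ A e.1.inf e.1.sup) fun e => by fun_prop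
  have h2 := integral_prod_eq_prod_image hξ (fun e => h.noise_measurable _ _)
    fun j => (⟨z j, hz j⟩ : {e : Sym2 (Fin n) // ¬ e.IsDiag})
  have h3 : Finset.univ.image z =
      (Finset.univ.image fun j => (⟨z j, hz j⟩ : {e : Sym2 (Fin n) // ¬ e.IsDiag})).image
        Subtype.val := by
    rw [Finset.image_image]; rfl
  rw [h3, Finset.prod_image fun a _ b _ hab => Subtype.ext hab]
  convert! h2 using 6 with e he
  simp [Subtype.ext_iff]

/-- Each distinct edge yields a factor `q` times its `moment3`. There are at least as many edges as
visited nodes minus one, and `q ≤ 1`, so the exponent may be lowered to a function of the node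
count, which the comparison can handle. -/
theorem abs_integral_walkProd_noise_le (h : IsSBM μ π₁ r w lam n A) {q : ℝ} (hq1 : q ≤ 1)
    (hq : ∀ i j, expMatrix μ A i j ≤ q) {k : ℕ} (u : Fin (k + 1) → Fin n) :
    |∫ x, walkProd (noise μ A x) u ∂μ| ≤
      q ^ ((Finset.univ.image u).card - 1) * walkWeight u := by
  have hq0 : 0 ≤ q := (h.expMatrix_apply_mem (u 0) (u 0)).1.trans (hq _ _)
  unfold walkWeight
  split_ifs with hd
  · obtain ⟨i, hi⟩ := hd
    have : ∀ x, walkProd (noise μ A x) u = 0 := fun x => by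
      refine Finset.prod_eq_zero (Finset.mem_univ i) ?_
      rw [step, Sym2.mk_isDiag_iff] at hi
      rw [hi, h.noise_diag]
    simp [this]
  push Not at hd
  have e : ∀ x, walkProd (noise μ A x) u =
      ∏ i, noise μ A x (step u i).inf (step u i).sup := fun x =>
    Finset.prod_congr rfl fun i _ => h.noise_eq_inf_sup x _ _
  simp_rw [e]
  rw [h.integral_prod_noise _ hd, Finset.abs_prod]
  have hpos : ∀ e ∈ Finset.univ.image (step u),
      1 ≤ (Finset.univ.filter fun i => step u i = e).card := fun e he => by
    obtain ⟨i, -, hi⟩ := Finset.mem_image.1 he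
    exact Finset.card_pos.2 ⟨i, by simp [hi]⟩
  calc _ ≤ ∏ e ∈ Finset.univ.image (step u),
        q * moment3 (Finset.univ.filter fun i => step u i = e).card := by
        refine Finset.prod_le_prod (fun e _ => abs_nonneg _) fun e he => ?_
        exact (h.abs_integral_noise_pow_le _ _ (hpos e he)).trans
          (mul_le_mul_of_nonneg_right (hq _ _) (moment3_nonneg (hpos e he)))
    _ = q ^ (Finset.univ.image (step u)).card * ∏ e ∈ Finset.univ.image (step u),
        moment3 (Finset.univ.filter fun i => step u i = e).card := by
        rw [Finset.prod_mul_distrib, Finset.prod_const]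
    _ ≤ _ := by
        refine mul_le_mul_of_nonneg_right (pow_le_pow_of_le_one hq0 hq1 ?_)
          (Finset.prod_nonneg fun e he => moment3_nonneg (hpos e he))
        have := card_image_le_card_image_step_add_one u
        omega

theorem walkProd_noise_integrable (h : IsSBM μ π₁ r w lam n A) {k : ℕ} (u : Fin (k + 1) → Fin n) :
    Integrable (fun x => walkProd (noise μ A x) u) μ := by
  refine Integrable.of_bound (Finset.measurable_prod _ fun i _ =>
    h.noise_measurable _ _).aestronglyMeasurable 1 (ae_of_all _ fun x => ?_)
  rw [walkProd, Real.norm_eq_abs, Finset.abs_prod]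
  exact Finset.prod_le_one (fun i _ => abs_nonneg _) fun i _ => h.abs_noise_le_one x _ _

theorem trace_noise_pow_integrable (h : IsSBM μ π₁ r w lam n A) (k : ℕ) :
    Integrable (fun x => ((noise μ A x) ^ k).trace) μ := by
  simp_rw [trace_pow_eq_sum_walkProd]
  refine integrable_finsetSum _ fun u _ => ?_
  split_ifs
  · exact h.walkProd_noise_integrable u
  · simp

end IsSBM

/-! ### The dense comparison matrix -/

/-- The values of the uniform distribution on `{2, -1, -1}`. -/
def val3 (t : Fin 3) : ℝ := if t = 0 then 2 else -1

theorem sum_val3_pow (k : ℕ) : ∑ t, val3 t ^ k = 3 * moment3 k := by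
  simp [Fin.sum_univ_three, val3, moment3]
  ring

/-- A symmetric matrix with zero diagonal whose entries are values of `val3`. -/
def mat3 {R : ℕ} (g : Sym2 (Fin R) → Fin 3) : Matrix (Fin R) (Fin R) ℝ :=
  Matrix.of fun i j => if i = j then 0 else val3 (g s(i, j))

theorem mat3_isSymm {R : ℕ} (g : Sym2 (Fin R) → Fin 3) : (mat3 g).IsSymm := by
  ext i j
  simp [mat3, eq_comm, Sym2.eq_swap]

theorem sum_prod_val3 {ι : Type*} [Fintype ι] [DecidableEq ι] (f : ι → Fin 3 → ℝ) :
    ∑ g : ι → Fin 3, ∏ e, f e (g e) = ∏ e, ∑ t, f e t := by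
  rw [Finset.prod_univ_sum, Fintype.piFinset_univ]

/-- Averages of products of entries of `mat3`. -/
theorem sum_walkProd_mat3 {R k : ℕ} (u : Fin (k + 1) → Fin R) :
    ∑ g : Sym2 (Fin R) → Fin 3, walkProd (mat3 g) u =
      3 ^ Fintype.card (Sym2 (Fin R)) * walkWeight u := by
  unfold walkWeight
  split_ifs with hd
  · obtain ⟨i, hi⟩ := hd
    rw [mul_zero]
    refine Finset.sum_eq_zero fun g _ => Finset.prod_eq_zero (Finset.mem_univ i) ?_
    rw [step, Sym2.mk_isDiag_iff] at hi
    simp [mat3, hi]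
  push Not at hd
  have e : ∀ g : Sym2 (Fin R) → Fin 3, walkProd (mat3 g) u =
      ∏ e, val3 (g e) ^ (Finset.univ.filter fun j => step u j = e).card := by
    intro g
    have h1 : walkProd (mat3 g) u = ∏ i, val3 (g (step u i)) := by
      refine Finset.prod_congr rfl fun i _ => ?_
      have := hd i
      rw [step, Sym2.mk_isDiag_iff] at this
      simp [mat3, this, step]
    rw [h1, Finset.prod_comp (fun e => val3 (g e)) (step u)]
    refine Finset.prod_subset (Finset.subset_univ _) fun i _ hi => ?_
    have : (Finset.univ.filter fun j => step u j = i) = ∅ := by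
      rw [Finset.filter_eq_empty_iff]
      exact fun j _ hj => hi (Finset.mem_image.2 ⟨j, Finset.mem_univ _, hj⟩)
    rw [this, Finset.card_empty, pow_zero]
  simp_rw [e]
  rw [sum_prod_val3 fun e t => val3 t ^ (Finset.univ.filter fun j => step u j = e).card]
  simp_rw [sum_val3_pow]
  rw [Finset.prod_mul_distrib, Finset.prod_const, Finset.card_univ]
  congr 1
  symm
  -- Edges that the walk does not use are harmless because `moment3 0 = 1`.
  refine Finset.prod_subset (Finset.subset_univ _) fun i _ hi => ?_
  have : (Finset.univ.filter fun j => step u j = i) = ∅ := by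
    rw [Finset.filter_eq_empty_iff]
    exact fun j _ hj => hi (Finset.mem_image.2 ⟨j, Finset.mem_univ _, hj⟩)
  rw [this, Finset.card_empty]
  norm_num [moment3]

/-- Comparison of the moments of the noise with those of a small dense matrix. -/
theorem IsSBM.integral_trace_noise_pow_le {Ω : Type*} [MeasurableSpace Ω] {μ : Measure Ω}
    [IsProbabilityMeasure μ] {π₁ r w lam : ℝ} {n : ℕ} {A : Ω → Matrix (Fin n) (Fin n) ℝ}
    (h : IsSBM μ π₁ r w lam n A) {L : ℝ} (hL : 0 ≤ L) (hn : 0 < n) (hL1 : L / n ≤ 1)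
    (hq : ∀ i j, expMatrix μ A i j ≤ L / n) {p R : ℕ} (hR : L + p ≤ R) (hR0 : 0 < R) :
    ∫ x, ((noise μ A x) ^ (2 * p)).trace ∂μ ≤ (n / R : ℝ) *
      ((∑ g : Sym2 (Fin R) → Fin 3, ((mat3 g) ^ (2 * p)).trace) /
        3 ^ Fintype.card (Sym2 (Fin R))) := by
  have h3 : (3 : ℝ) ^ Fintype.card (Sym2 (Fin R)) ≠ 0 := by positivity
  have e : (∑ g : Sym2 (Fin R) → Fin 3, ((mat3 g) ^ (2 * p)).trace) /
      3 ^ Fintype.card (Sym2 (Fin R)) =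
      ∑ u : Fin (2 * p + 1) → Fin R, (if u 0 = u (Fin.last _) then walkWeight u else 0) := by
    simp_rw [trace_pow_eq_sum_walkProd]
    rw [Finset.sum_comm, div_eq_iff h3, Finset.sum_mul]
    refine Finset.sum_congr rfl fun u _ => ?_
    split_ifs
    · rw [sum_walkProd_mat3, mul_comm]
    · simp
  rw [e]
  refine le_trans ?_ (sum_walkWeight_le hL hn hR hR0)
  simp_rw [trace_pow_eq_sum_walkProd]
  rw [integral_finsetSum]
  · refine Finset.sum_le_sum fun u _ => ?_
    split_ifs
    · exact (le_abs_self _).trans (h.abs_integral_walkProd_noise_le hL1 hq u)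
    · simp
  · intro u _
    split_ifs
    · exact h.walkProd_noise_integrable u
    · simp

/-! ### Eigenvalues, norms and traces of symmetric matrices -/

section LinearAlgebra

variable {α : Type*} [Fintype α]

theorem zero_le_dotProduct_self (x : α → ℝ) : 0 ≤ x ⬝ᵥ x :=
  Finset.sum_nonneg fun i _ => mul_self_nonneg _

theorem dotProduct_self_pos_of_ne_zero {x : α → ℝ} (hx : x ≠ 0) : 0 < x ⬝ᵥ x :=
  (zero_le_dotProduct_self x).lt_of_ne fun h => hx (dotProduct_self_eq_zero.1 h.symm)

theorem dotProduct_sq_le (x y : α → ℝ) : (x ⬝ᵥ y) ^ 2 ≤ (x ⬝ᵥ x) * (y ⬝ᵥ y) := by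
  simpa [dotProduct, ← pow_two] using Finset.sum_mul_sq_le_sq_mul_sq Finset.univ x y

theorem norm_toLp_sq (x : α → ℝ) : ‖WithLp.toLp 2 x‖ ^ 2 = x ⬝ᵥ x := by
  rw [EuclideanSpace.real_norm_sq_eq]
  exact Finset.sum_congr rfl fun i _ => pow_two _

theorem dotProduct_mulVec_comm {M : Matrix α α ℝ} (hM : M.IsSymm) (x y : α → ℝ) :
    x ⬝ᵥ M *ᵥ y = (M *ᵥ x) ⬝ᵥ y := by
  rw [dotProduct_mulVec, ← mulVec_transpose, hM.eq]

theorem isHermitian_of_isSymm {M : Matrix α α ℝ} (hM : M.IsSymm) : M.IsHermitian := by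
  rw [Matrix.IsHermitian, conjTranspose_eq_transpose_of_trivial, hM.eq]

/-- A symmetric matrix whose eigenvalues are bounded by `τ` has operator norm at most `τ`. -/
theorem mulVec_sq_le_of_eigenvalues_le [DecidableEq α] {M : Matrix α α ℝ} (hM : M.IsSymm) {τ : ℝ}
    (h : ∀ (ν : ℝ) (v : α → ℝ), v ≠ 0 → M *ᵥ v = ν • v → |ν| ≤ τ) (x : α → ℝ) :
    (M *ᵥ x) ⬝ᵥ (M *ᵥ x) ≤ τ ^ 2 * (x ⬝ᵥ x) := by
  have hH := isHermitian_of_isSymm hM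
  set b := hH.eigenvectorBasis
  have hv : ∀ j, |hH.eigenvalues j| ≤ τ := fun j => by
    refine h _ (b j) (fun h0 => ?_) (hH.mulVec_eigenvectorBasis j)
    refine b.orthonormal.ne_zero j ?_
    ext i
    exact congrFun h0 i
  rw [← norm_toLp_sq, ← norm_toLp_sq, ← b.sum_sq_inner_right, ← b.sum_sq_inner_right,
    Finset.mul_sum]
  refine Finset.sum_le_sum fun j _ => ?_
  have : inner ℝ (b j) (WithLp.toLp 2 (M *ᵥ x)) =
      hH.eigenvalues j * inner ℝ (b j) (WithLp.toLp 2 x) := by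
    simp only [EuclideanSpace.inner_eq_star_dotProduct, star_trivial]
    rw [← dotProduct_mulVec_comm hM]
    rw [hH.mulVec_eigenvectorBasis, dotProduct_smul, smul_eq_mul]
  rw [this, mul_pow]
  refine mul_le_mul_of_nonneg_right ?_ (sq_nonneg _)
  exact sq_le_sq' (abs_le.1 (hv j)).1 (abs_le.1 (hv j)).2

/-- An eigenvector of largest absolute eigenvalue. -/
theorem exists_eigenvector_norm_le [DecidableEq α] [Nonempty α] {M : Matrix α α ℝ}
    (hM : M.IsSymm) :
    ∃ (ν : ℝ) (v : α → ℝ), v ⬝ᵥ v = 1 ∧ M *ᵥ v = ν • v ∧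
      ∀ x, (M *ᵥ x) ⬝ᵥ (M *ᵥ x) ≤ ν ^ 2 * (x ⬝ᵥ x) := by
  have hH := isHermitian_of_isSymm hM
  set b := hH.eigenvectorBasis
  obtain ⟨j, hj⟩ := Finite.exists_max fun j => hH.eigenvalues j ^ 2
  refine ⟨hH.eigenvalues j, b j, ?_, hH.mulVec_eigenvectorBasis j, fun x => ?_⟩
  · rw [← norm_toLp_sq]
    simp
  rw [← norm_toLp_sq, ← norm_toLp_sq, ← b.sum_sq_inner_right, ← b.sum_sq_inner_right,
    Finset.mul_sum]
  refine Finset.sum_le_sum fun i _ => ?_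
  have : inner ℝ (b i) (WithLp.toLp 2 (M *ᵥ x)) =
      hH.eigenvalues i * inner ℝ (b i) (WithLp.toLp 2 x) := by
    simp only [EuclideanSpace.inner_eq_star_dotProduct, star_trivial]
    rw [← dotProduct_mulVec_comm hM]
    rw [hH.mulVec_eigenvectorBasis, dotProduct_smul, smul_eq_mul]
  rw [this, mul_pow]
  exact mul_le_mul_of_nonneg_right (hj i) (sq_nonneg _)

theorem pow_isSymm [DecidableEq α] {M : Matrix α α ℝ} (hM : M.IsSymm) (p : ℕ) :
    (M ^ p).IsSymm := by
  rw [Matrix.IsSymm, transpose_pow, hM.eq]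

theorem pow_mulVec_eigenvector [DecidableEq α] {M : Matrix α α ℝ} {ν : ℝ} {v : α → ℝ}
    (h : M *ᵥ v = ν • v) (p : ℕ) : (M ^ p) *ᵥ v = ν ^ p • v := by
  induction p with
  | zero => simp
  | succ p ih => rw [pow_succ', ← mulVec_mulVec, ih, mulVec_smul, h, smul_smul, pow_succ]

theorem trace_pow_two_mul [DecidableEq α] {M : Matrix α α ℝ} (hM : M.IsSymm) (p : ℕ) :
    (M ^ (2 * p)).trace = ∑ i, (M ^ p) i ⬝ᵥ (M ^ p) i := by
  rw [two_mul, pow_add, Matrix.trace]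
  refine Finset.sum_congr rfl fun i _ => ?_
  rw [Matrix.diag, Matrix.mul_apply]
  refine Finset.sum_congr rfl fun j _ => ?_
  rw [(pow_isSymm hM p).apply]

/-- The trace is the squared Frobenius norm of `M ^ p`, which by Cauchy-Schwarz in each row
dominates the squared length of `M ^ p` applied to a unit vector. -/
theorem eigenvalue_pow_le_trace [DecidableEq α] {M : Matrix α α ℝ} (hM : M.IsSymm) {ν : ℝ}
    {v : α → ℝ} (hv : v ⬝ᵥ v = 1) (h : M *ᵥ v = ν • v) (p : ℕ) :
    ν ^ (2 * p) ≤ (M ^ (2 * p)).trace := by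
  have h1 : ((M ^ p) *ᵥ v) ⬝ᵥ ((M ^ p) *ᵥ v) = ν ^ (2 * p) := by
    rw [pow_mulVec_eigenvector h]
    simp [hv]
    ring
  rw [← h1, trace_pow_two_mul hM]
  refine Finset.sum_le_sum fun i _ => ?_
  rw [← pow_two]
  refine (dotProduct_sq_le _ _).trans ?_
  rw [hv, mul_one]

theorem pow_mulVec_sq_le [DecidableEq α] {M : Matrix α α ℝ} {τ : ℝ}
    (h : ∀ x, (M *ᵥ x) ⬝ᵥ (M *ᵥ x) ≤ τ ^ 2 * (x ⬝ᵥ x)) (p : ℕ) (x : α → ℝ) :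
    ((M ^ p) *ᵥ x) ⬝ᵥ ((M ^ p) *ᵥ x) ≤ τ ^ (2 * p) * (x ⬝ᵥ x) := by
  induction p with
  | zero => simp
  | succ p ih =>
    rw [pow_succ', ← mulVec_mulVec]
    refine (h _).trans ?_
    rw [mul_add, pow_add, mul_comm (τ ^ (2 * p)), mul_assoc, mul_one]
    gcongr

theorem trace_pow_le [DecidableEq α] {M : Matrix α α ℝ} (hM : M.IsSymm) {τ : ℝ}
    (h : ∀ x, (M *ᵥ x) ⬝ᵥ (M *ᵥ x) ≤ τ ^ 2 * (x ⬝ᵥ x)) (p : ℕ) :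
    (M ^ (2 * p)).trace ≤ Fintype.card α * τ ^ (2 * p) := by
  rw [trace_pow_two_mul hM, ← nsmul_eq_mul, ← Finset.card_univ, ← Finset.sum_const]
  refine Finset.sum_le_sum fun i _ => ?_
  have := pow_mulVec_sq_le h p (Pi.single i 1)
  have e : (M ^ p) *ᵥ (Pi.single i 1) = (M ^ p) i := by
    ext j
    simp [(pow_isSymm hM p).apply]
  rw [e] at this
  simpa using this

end LinearAlgebra

/-! ### Norm moments of the dense matrix -/

/-- Points of mesh `1 / (4 R)` in a ball. -/
noncomputable def gridPoints (R : ℕ) : Finset (Fin R → ℝ) :=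
  ((Fintype.piFinset fun _ : Fin R => Finset.Icc (-(4 * R : ℤ)) (4 * R)).image
    fun k i => (k i : ℝ) / (4 * R)).filter fun z => z ⬝ᵥ z ≤ 2

theorem card_gridPoints_le (R : ℕ) : (gridPoints R).card ≤ (8 * R + 1) ^ R := by
  refine (Finset.card_filter_le _ _).trans (Finset.card_image_le.trans ?_)
  rw [Fintype.card_piFinset_const, Int.card_Icc]
  refine le_of_eq ?_
  congr 1
  omega

/-- Rounding to the grid moves each coordinate by at most `1 / (8 * R)`, hence the vector by at most
`1 / 8`. The rounded vector has squared norm at most `1 + 1 / 4 + 1 / 64`, inside the ball that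
defines the grid. -/
theorem exists_gridPoint {R : ℕ} (hR : 0 < R) {v : Fin R → ℝ} (hv : v ⬝ᵥ v = 1) :
    ∃ z ∈ gridPoints R, (z - v) ⬝ᵥ (z - v) ≤ 1 / 64 := by
  have hR' : (1 : ℝ) ≤ R := by exact_mod_cast hR
  let z : Fin R → ℝ := fun i => (round (4 * R * v i) : ℝ) / (4 * R)
  have hz : ∀ i, |z i - v i| ≤ 1 / (8 * R) := fun i => by
    have := abs_sub_round (4 * R * v i)
    have e : z i - v i = -(4 * R * v i - round (4 * R * v i)) / (4 * R) := by
      simp only [z]; field_simp; ring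
    rw [e, abs_div, abs_neg, abs_of_pos (by positivity : (0 : ℝ) < 4 * R),
      div_le_div_iff₀ (by positivity) (by positivity)]
    nlinarith
  have hd : (z - v) ⬝ᵥ (z - v) ≤ 1 / 64 := by
    calc (z - v) ⬝ᵥ (z - v) ≤ ∑ _i : Fin R, (1 / (8 * R) : ℝ) ^ 2 := by
          refine Finset.sum_le_sum fun i _ => ?_
          rw [← pow_two, Pi.sub_apply, ← sq_abs]
          gcongr
          exact hz i
      _ = 1 / (64 * R) := by
          rw [Finset.sum_const, Finset.card_univ, Fintype.card_fin, nsmul_eq_mul]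
          field_simp
          norm_num
      _ ≤ 1 / 64 := by
          gcongr
          linarith
  refine ⟨z, ?_, hd⟩
  unfold gridPoints
  rw [Finset.mem_filter, Finset.mem_image]
  refine ⟨⟨fun i => round (4 * R * v i), ?_, rfl⟩, ?_⟩
  · rw [Fintype.mem_piFinset]
    intro i
    have h1 : v i ^ 2 ≤ 1 := by
      rw [← hv, pow_two]
      exact Finset.single_le_sum (f := fun i => v i * v i) (fun i _ => mul_self_nonneg _)
        (Finset.mem_univ i)
    have h2 := abs_le.1 (by simpa using (sq_le_one_iff_abs_le_one (v i)).1 h1)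
    have h6 := abs_le.1 (abs_sub_round (4 * R * v i))
    rw [Finset.mem_Icc, ← Int.lt_add_one_iff, ← Int.lt_add_one_iff (a := round _)]
    rify
    constructor <;> nlinarith
  · have h3 : z ⬝ᵥ z = 1 + 2 * ((z - v) ⬝ᵥ v) + (z - v) ⬝ᵥ (z - v) := by
      rw [← hv]
      simp only [sub_dotProduct, dotProduct_sub, dotProduct_comm v z]
      ring
    have h4 := dotProduct_sq_le (z - v) v
    rw [hv, mul_one] at h4
    have h5 : (z - v) ⬝ᵥ v ≤ 1 / 8 := by
      refine le_of_sq_le_sq ?_ (by norm_num)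
      linarith
    linarith

/-- The operator norm is attained, up to a factor, at a grid point. -/
theorem exists_norm_le_gridPoint {R : ℕ} (hR : 0 < R) {M : Matrix (Fin R) (Fin R) ℝ}
    (hM : M.IsSymm) :
    ∃ τ : ℝ, (∀ x, (M *ᵥ x) ⬝ᵥ (M *ᵥ x) ≤ τ ^ 2 * (x ⬝ᵥ x)) ∧
      ∃ z ∈ gridPoints R, τ ^ 2 ≤ 4 * (z ⬝ᵥ M *ᵥ z) ^ 2 := by
  have : Nonempty (Fin R) := ⟨⟨0, hR⟩⟩
  obtain ⟨ν, v, hv, hMv, hb⟩ := exists_eigenvector_norm_le hM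
  obtain ⟨z, hz, hd⟩ := exists_gridPoint hR hv
  refine ⟨ν, hb, z, hz, ?_⟩
  set d := z - v with hd'
  have hzd : z = v + d := by simp [d]
  have e : z ⬝ᵥ M *ᵥ z = ν + 2 * (ν * (d ⬝ᵥ v)) + d ⬝ᵥ M *ᵥ d := by
    rw [hzd, mulVec_add, add_dotProduct, dotProduct_add, dotProduct_add,
      dotProduct_mulVec_comm hM v d, hMv]
    simp only [dotProduct_smul, smul_dotProduct, hv, smul_eq_mul, dotProduct_comm v d]
    ring
  have h1 : |d ⬝ᵥ v| ≤ 1 / 8 := by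
    refine abs_le_of_sq_le_sq ?_ (by norm_num)
    have := dotProduct_sq_le d v
    rw [hv] at this
    linarith
  have h2 : |d ⬝ᵥ M *ᵥ d| ≤ |ν| / 64 := by
    refine abs_le_of_sq_le_sq ?_ (by positivity)
    have h3 := dotProduct_sq_le d (M *ᵥ d)
    have h4 := hb d
    have h5 := zero_le_dotProduct_self d
    rw [div_pow, sq_abs]
    calc _ ≤ _ := h3
      _ ≤ (d ⬝ᵥ d) * (ν ^ 2 * (d ⬝ᵥ d)) := by gcongr
      _ = ν ^ 2 * ((d ⬝ᵥ d) * (d ⬝ᵥ d)) := by ring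
      _ ≤ ν ^ 2 * ((1 / 64) * (1 / 64)) := by gcongr
      _ = _ := by ring
  -- The linear and quadratic errors of the rounding cost at most `|ν| / 4` and `|ν| / 64`, which
  -- are absorbed on the left.
  have h6 : |ν| ≤ 2 * |z ⬝ᵥ M *ᵥ z| := by
    have h7 : |ν| ≤ |z ⬝ᵥ M *ᵥ z| + |2 * (ν * (d ⬝ᵥ v))| + |d ⬝ᵥ M *ᵥ d| := by
      have : ν = z ⬝ᵥ M *ᵥ z - 2 * (ν * (d ⬝ᵥ v)) - d ⬝ᵥ M *ᵥ d := by rw [e]; ring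
      nth_rw 1 [this]
      exact (abs_sub _ _).trans (by gcongr; exact abs_sub _ _)
    have h8 : |2 * (ν * (d ⬝ᵥ v))| ≤ |ν| / 4 := by
      rw [abs_mul, abs_mul, abs_two]
      nlinarith [abs_nonneg ν]
    linarith [abs_nonneg ν]
  have : |ν| ^ 2 ≤ (2 * |z ⬝ᵥ M *ᵥ z|) ^ 2 := by gcongr
  rw [mul_pow, sq_abs, sq_abs] at this
  linarith

/-- Symmetrization: since the mean is zero, the average of `exp (-t X')` for an independent copy
`X'` is at least 1, so inserting it as a factor only increases the sum. The difference `X - X'`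
takes the values 0, 3 and -3, and `cosh (3 * t)` is at most `exp (9 / 2 * t ^ 2)`. -/
theorem sum_exp_val3_le (t : ℝ) :
    ∑ s, Real.exp (t * val3 s) ≤ 3 * Real.exp (9 / 2 * t ^ 2) := by
  simp only [Fin.sum_univ_three, val3]
  simp only [Fin.isValue, ↓reduceIte, one_ne_zero]
  have h2 : (2 : Fin 3) ≠ 0 := by decide
  simp only [h2, ↓reduceIte]
  set a := Real.exp (t * 2)
  set b := Real.exp (t * -1)
  have h1 := Real.add_one_le_exp (-(t * 2))
  have h2 := Real.add_one_le_exp (-(t * -1))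
  have e3 : Real.exp (-(t * 2)) = a⁻¹ := Real.exp_neg _
  have e4 : Real.exp (-(t * -1)) = b⁻¹ := Real.exp_neg _
  rw [e3] at h1
  rw [e4] at h2
  have ha : 0 < a := Real.exp_pos _
  have hb : 0 < b := Real.exp_pos _
  have hab : a * b⁻¹ = Real.exp (3 * t) := by
    rw [← e4, ← Real.exp_add]; ring_nf
  have hba : b * a⁻¹ = Real.exp (-(3 * t)) := by
    rw [← e3, ← Real.exp_add]; ring_nf
  have hc := Real.cosh_le_exp_half_sq (3 * t)
  have hc1 := Real.one_le_cosh (3 * t)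
  have e5 : (3 * t) ^ 2 / 2 = 9 / 2 * t ^ 2 := by ring
  rw [e5] at hc
  have hch : Real.exp (3 * t) + Real.exp (-(3 * t)) = 2 * Real.cosh (3 * t) := by
    rw [Real.cosh_eq]; ring
  have h6 : a + b + b ≤ (a + b + b) * ((a⁻¹ + b⁻¹ + b⁻¹) / 3) :=
    le_mul_of_one_le_right (by positivity) (by linarith)
  have h7 : (a + b + b) * ((a⁻¹ + b⁻¹ + b⁻¹) / 3) = (5 + 2 * (a * b⁻¹ + b * a⁻¹)) / 3 := by
    field_simp; ring
  rw [h7, hab, hba, hch] at h6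
  linarith

/-- The coefficients of the quadratic form of `mat3` at `z`. -/
def edgeCoeff {R : ℕ} (z : Fin R → ℝ) (e : Sym2 (Fin R)) : ℝ :=
  ∑ a : Fin R × Fin R with s(a.1, a.2) = e, if a.1 = a.2 then 0 else z a.1 * z a.2

theorem dotProduct_mat3_mulVec {R : ℕ} (g : Sym2 (Fin R) → Fin 3) (z : Fin R → ℝ) :
    z ⬝ᵥ mat3 g *ᵥ z = ∑ e, edgeCoeff z e * val3 (g e) := by
  have h1 : z ⬝ᵥ mat3 g *ᵥ z = ∑ a : Fin R × Fin R,
      (if a.1 = a.2 then 0 else z a.1 * z a.2) * val3 (g s(a.1, a.2)) := by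
    rw [Fintype.sum_prod_type]
    refine Finset.sum_congr rfl fun i _ => ?_
    rw [mulVec, dotProduct, Finset.mul_sum]
    refine Finset.sum_congr rfl fun j _ => ?_
    simp only [mat3, Matrix.of_apply]
    split_ifs <;> ring
  rw [h1, ← Finset.sum_fiberwise (s := Finset.univ) (g := fun a : Fin R × Fin R => s(a.1, a.2))]
  refine Finset.sum_congr rfl fun e _ => ?_
  rw [edgeCoeff, Finset.sum_mul]
  refine Finset.sum_congr rfl fun a ha => ?_
  rw [(Finset.mem_filter.1 ha).2]

/-- At most two ordered pairs lie over an unordered one, so Cauchy-Schwarz in each fibre loses a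
factor 2. -/
theorem sum_edgeCoeff_sq_le {R : ℕ} (z : Fin R → ℝ) :
    ∑ e, edgeCoeff z e ^ 2 ≤ 2 * (z ⬝ᵥ z) ^ 2 := by
  have h1 : ∀ e, edgeCoeff z e ^ 2 ≤
      2 * ∑ a : Fin R × Fin R with s(a.1, a.2) = e, (z a.1 * z a.2) ^ 2 := by
    intro e
    unfold edgeCoeff
    refine sq_sum_le_card_mul_sum_sq.trans ?_
    have hc : (Finset.univ.filter fun a : Fin R × Fin R => s(a.1, a.2) = e).card ≤ 2 := by
      induction e using Sym2.ind with
      | _ i j =>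
        refine (Finset.card_le_card (t := {(i, j), (j, i)}) fun a ha => ?_).trans Finset.card_le_two
        have := (Finset.mem_filter.1 ha).2
        rw [Sym2.eq_iff] at this
        simp only [Finset.mem_insert, Finset.mem_singleton, Prod.ext_iff]
        exact this
    have hs : 0 ≤ ∑ a : Fin R × Fin R with s(a.1, a.2) = e, (z a.1 * z a.2) ^ 2 :=
      Finset.sum_nonneg fun a _ => sq_nonneg _
    calc _ ≤ ((Finset.univ.filter fun a : Fin R × Fin R => s(a.1, a.2) = e).card : ℝ) *
          ∑ a : Fin R × Fin R with s(a.1, a.2) = e, (z a.1 * z a.2) ^ 2 := by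
          refine mul_le_mul_of_nonneg_left (Finset.sum_le_sum fun a _ => ?_) (by positivity)
          split_ifs
          · simpa using sq_nonneg (z a.1 * z a.2)
          · exact le_rfl
      _ ≤ _ := by
          gcongr
          exact_mod_cast hc
  calc ∑ e, edgeCoeff z e ^ 2 ≤ ∑ e, 2 * ∑ a : Fin R × Fin R with s(a.1, a.2) = e,
        (z a.1 * z a.2) ^ 2 := Finset.sum_le_sum fun e _ => h1 e
    _ = 2 * ∑ a : Fin R × Fin R, (z a.1 * z a.2) ^ 2 := by
        rw [← Finset.mul_sum, Finset.sum_fiberwise]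
    _ = 2 * (z ⬝ᵥ z) ^ 2 := by
        rw [Fintype.sum_prod_type, pow_two (z ⬝ᵥ z), dotProduct, Finset.sum_mul_sum]
        simp_rw [mul_pow, pow_two]

theorem sum_exp_form_le {R : ℕ} {z : Fin R → ℝ} (hz : z ⬝ᵥ z ≤ 2) (t : ℝ) :
    ∑ g : Sym2 (Fin R) → Fin 3, Real.exp (t * (z ⬝ᵥ mat3 g *ᵥ z)) ≤
      3 ^ Fintype.card (Sym2 (Fin R)) * Real.exp (36 * t ^ 2) := by
  have e : ∀ g : Sym2 (Fin R) → Fin 3, Real.exp (t * (z ⬝ᵥ mat3 g *ᵥ z)) =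
      ∏ e, Real.exp (t * edgeCoeff z e * val3 (g e)) := fun g => by
    rw [dotProduct_mat3_mulVec, Finset.mul_sum, Real.exp_sum]
    simp_rw [mul_assoc]
  simp_rw [e]
  rw [sum_prod_val3 fun e s => Real.exp (t * edgeCoeff z e * val3 s)]
  calc _ ≤ ∏ e : Sym2 (Fin R), (3 * Real.exp (9 / 2 * (t * edgeCoeff z e) ^ 2)) :=
        Finset.prod_le_prod (fun e _ => Finset.sum_nonneg fun s _ => (Real.exp_pos _).le)
          fun e _ => sum_exp_val3_le _
    _ = 3 ^ Fintype.card (Sym2 (Fin R)) *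
        Real.exp (9 / 2 * t ^ 2 * ∑ e : Sym2 (Fin R), edgeCoeff z e ^ 2) := by
        rw [Finset.prod_mul_distrib, Finset.prod_const, Finset.card_univ, ← Real.exp_sum,
          Finset.mul_sum]
        simp_rw [mul_pow, mul_assoc]
    _ ≤ _ := by
        refine mul_le_mul_of_nonneg_left (Real.exp_le_exp.2 ?_) (by positivity)
        have h1 := sum_edgeCoeff_sq_le z
        have h2 := zero_le_dotProduct_self z
        have h3 : (z ⬝ᵥ z) ^ 2 ≤ 2 ^ 2 := by gcongr
        nlinarith [sq_nonneg t]

/-- One term of the exponential series at `√P * |t|` is used, with `(2P)! ≤ (2P) ^ (2P)`. The scale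
`√P` is the one at which a sub-Gaussian variable has `2P`-th moment of order `(const * P) ^ P`. -/
theorem pow_le_exp_add_exp {t : ℝ} {P : ℕ} (hP : 0 < P) :
    t ^ (2 * P) ≤ (4 * P) ^ P * (Real.exp (√P * t) + Real.exp (-√P * t)) := by
  have hP' : (0 : ℝ) < P := by exact_mod_cast hP
  have h1 := Real.pow_div_factorial_le_exp (x := √P * |t|) (by positivity) (2 * P)
  have h2 : Real.exp (√P * |t|) ≤ Real.exp (√P * t) + Real.exp (-√P * t) := by
    rcases abs_choice t with h | h <;> rw [h]
    · exact le_add_of_nonneg_right (Real.exp_pos _).le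
    · rw [mul_neg, ← neg_mul]
      exact le_add_of_nonneg_left (Real.exp_pos _).le
  have h3 : ((2 * P).factorial : ℝ) ≤ (2 * P) ^ (2 * P) := by
    exact_mod_cast Nat.factorial_le_pow (2 * P)
  have h4 : (√P * |t|) ^ (2 * P) = P ^ P * t ^ (2 * P) := by
    rw [mul_pow, pow_mul, pow_mul, Real.sq_sqrt hP'.le, sq_abs, ← pow_mul]
  rw [h4, div_le_iff₀ (by positivity)] at h1
  have h5 : (P : ℝ) ^ P * t ^ (2 * P) ≤ P ^ P * ((4 * P) ^ P *
      (Real.exp (√P * t) + Real.exp (-√P * t))) := by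
    calc _ ≤ _ := h1
      _ ≤ (Real.exp (√P * t) + Real.exp (-√P * t)) * (2 * P) ^ (2 * P) := by gcongr
      _ = _ := by
        rw [pow_mul (2 * (P : ℝ)), show (2 * (P : ℝ)) ^ 2 = P * (4 * P) by ring, mul_pow]
        ring
  exact le_of_mul_le_mul_left h5 (by positivity)

theorem sum_form_pow_le {R : ℕ} {z : Fin R → ℝ} (hz : z ⬝ᵥ z ≤ 2) {P : ℕ} (hP : 0 < P) :
    ∑ g : Sym2 (Fin R) → Fin 3, (z ⬝ᵥ mat3 g *ᵥ z) ^ (2 * P) ≤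
      3 ^ Fintype.card (Sym2 (Fin R)) * (2 * (4 * Real.exp 36 * P) ^ P) := by
  have hP' : (0 : ℝ) ≤ P := by positivity
  calc _ ≤ ∑ g : Sym2 (Fin R) → Fin 3, (4 * P : ℝ) ^ P *
        (Real.exp (√P * (z ⬝ᵥ mat3 g *ᵥ z)) + Real.exp (-√P * (z ⬝ᵥ mat3 g *ᵥ z))) :=
        Finset.sum_le_sum fun g _ => pow_le_exp_add_exp hP
    _ = (4 * P : ℝ) ^ P * (∑ g : Sym2 (Fin R) → Fin 3, Real.exp (√P * (z ⬝ᵥ mat3 g *ᵥ z)) +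
        ∑ g : Sym2 (Fin R) → Fin 3, Real.exp (-√P * (z ⬝ᵥ mat3 g *ᵥ z))) := by
        rw [← Finset.mul_sum, Finset.sum_add_distrib]
    _ ≤ (4 * P : ℝ) ^ P * (3 ^ Fintype.card (Sym2 (Fin R)) * Real.exp (36 * (√P) ^ 2) +
        3 ^ Fintype.card (Sym2 (Fin R)) * Real.exp (36 * (-√P) ^ 2)) := by
        gcongr
        · exact sum_exp_form_le hz _
        · exact sum_exp_form_le hz _
    _ = _ := by
        rw [neg_sq, Real.sq_sqrt hP', mul_comm (36 : ℝ), Real.exp_nat_mul]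
        simp only [mul_pow]
        ring

theorem sum_trace_mat3_pow_le_of_bound {R : ℕ} (hR : 0 < R) {ε : ℝ} (hε : 0 < ε)
    (hb : 2 * (8 * R + 1 : ℝ) ^ R * (32 * Real.exp 36 * R) ^ (2 * R) ≤ (ε * R) ^ (4 * R)) {p : ℕ}
    (hp : p ≤ 2 * R) :
    (∑ g : Sym2 (Fin R) → Fin 3, ((mat3 g) ^ (2 * p)).trace) / 3 ^ Fintype.card (Sym2 (Fin R)) ≤
      2 * R * (ε * R) ^ (2 * p) := by
  have hR' : (0 : ℝ) < R := by exact_mod_cast hR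
  -- The grid has about `R ^ R` points, and the moment of order `2 * P` contributes about `P ^ P`.
  -- With `P = 2 * R` their product is of order `R ^ (3 * R)` up to exponential factors, below the
  -- target `(ε * R) ^ (4 * R)`; `P = R` would only tie in the power of `R`.
  set P := 2 * R
  have hP : 0 < P := by omega
  set N : ℝ := 3 ^ Fintype.card (Sym2 (Fin R))
  have hN : 0 < N := by positivity
  have hNc : ∑ _g : Sym2 (Fin R) → Fin 3, (1 : ℝ) = N := by simp [N]
  have h1 : ∀ g : Sym2 (Fin R) → Fin 3, ((mat3 g) ^ (2 * p)).trace ≤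
      R * ((ε * R) ^ (2 * p) * (1 + 4 ^ P * (∑ z ∈ gridPoints R, (z ⬝ᵥ mat3 g *ᵥ z) ^ (2 * P)) /
        (ε * R) ^ (2 * P))) := by
    intro g
    obtain ⟨τ, hτ, z, hz, hτz⟩ := exists_norm_le_gridPoint hR (mat3_isSymm g)
    have h2 := trace_pow_le (mat3_isSymm g) hτ p
    rw [Fintype.card_fin] at h2
    refine h2.trans ?_
    gcongr
    have h3 : τ ^ (2 * P) ≤ 4 ^ P * ∑ z ∈ gridPoints R, (z ⬝ᵥ mat3 g *ᵥ z) ^ (2 * P) := by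
      calc τ ^ (2 * P) = (τ ^ 2) ^ P := pow_mul _ _ _
        _ ≤ (4 * (z ⬝ᵥ mat3 g *ᵥ z) ^ 2) ^ P := by gcongr
        _ = 4 ^ P * (z ⬝ᵥ mat3 g *ᵥ z) ^ (2 * P) := by rw [mul_pow, ← pow_mul]
        _ ≤ _ := by
          gcongr
          exact Finset.single_le_sum (f := fun z => (z ⬝ᵥ mat3 g *ᵥ z) ^ (2 * P))
            (fun z _ => by rw [pow_mul]; positivity) hz
    -- After normalization this is `y ^ p ≤ 1 + y ^ P`, which reduces all exponents `p ≤ P` to the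
    -- single exponent `P`.
    have h4 : τ ^ (2 * p) ≤ (ε * R) ^ (2 * p) * (1 + τ ^ (2 * P) / (ε * R) ^ (2 * P)) := by
      have e1 : τ ^ (2 * p) = (ε * R) ^ (2 * p) * ((τ / (ε * R)) ^ 2) ^ p := by
        rw [← pow_mul, div_pow]; field_simp
      rw [e1, ← div_pow, pow_mul (τ / (ε * R)) 2 P]
      gcongr
      set y := (τ / (ε * R)) ^ 2
      have hy : 0 ≤ y := sq_nonneg _
      rcases le_total y 1 with h | h
      · exact (pow_le_one₀ hy h).trans (by linarith [pow_nonneg hy P])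
      · exact (pow_le_pow_right₀ h hp).trans (by linarith)
    refine h4.trans ?_
    gcongr
  rw [div_le_iff₀ hN]
  calc _ ≤ ∑ g : Sym2 (Fin R) → Fin 3, R * ((ε * R) ^ (2 * p) *
        (1 + 4 ^ P * (∑ z ∈ gridPoints R, (z ⬝ᵥ mat3 g *ᵥ z) ^ (2 * P)) / (ε * R) ^ (2 * P))) :=
        Finset.sum_le_sum fun g _ => h1 g
    _ = R * ((ε * R) ^ (2 * p) * (N + 4 ^ P * (∑ z ∈ gridPoints R,
        ∑ g : Sym2 (Fin R) → Fin 3, (z ⬝ᵥ mat3 g *ᵥ z) ^ (2 * P)) / (ε * R) ^ (2 * P))) := by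
        rw [← Finset.mul_sum, ← Finset.mul_sum, Finset.sum_add_distrib, hNc, Finset.sum_comm,
          Finset.mul_sum, Finset.sum_div]
    _ ≤ R * ((ε * R) ^ (2 * p) * (N + N)) := by
        gcongr
        rw [div_le_iff₀ (by positivity)]
        calc _ ≤ 4 ^ P * ∑ z ∈ gridPoints R, N * (2 * (4 * Real.exp 36 * P) ^ P) := by
              gcongr with z hz
              exact sum_form_pow_le (Finset.mem_filter.1 hz).2 hP
          _ = N * ((gridPoints R).card * (2 * (4 * (4 * Real.exp 36 * P)) ^ P)) := by
              rw [Finset.sum_const, nsmul_eq_mul, mul_pow 4 (4 * Real.exp 36 * P)]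
              ring
          _ ≤ N * ((8 * R + 1 : ℝ) ^ R * (2 * (4 * (4 * Real.exp 36 * P)) ^ P)) := by
              gcongr
              exact_mod_cast card_gridPoints_le R
          _ = N * (2 * (8 * R + 1 : ℝ) ^ R * (32 * Real.exp 36 * R) ^ (2 * R)) := by
              have : (4 * (4 * Real.exp 36 * P)) = 32 * Real.exp 36 * R := by
                simp only [P]; push_cast; ring
              rw [this]
              ring
          _ ≤ _ := by
              rw [show 2 * P = 4 * R by omega]
              gcongr
    _ = _ := by ring

/-- The operator norm of `mat3` is `o(R)`, in terms of moments. -/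
theorem eventually_sum_trace_mat3_pow_le {ε : ℝ} (hε : 0 < ε) :
    ∀ᶠ R : ℕ in atTop, ∀ p ≤ 2 * R,
      (∑ g : Sym2 (Fin R) → Fin 3, ((mat3 g) ^ (2 * p)).trace) / 3 ^ Fintype.card (Sym2 (Fin R)) ≤
        2 * R * (ε * R) ^ (2 * p) := by
  -- Beyond this threshold, `18 * (32 * exp 36) ^ 2 * R ^ 3 ≤ ε ^ 4 * R ^ 4`, the `R`-th root of the
  -- inequality that has to be checked.
  set C : ℝ := 18 * (32 * Real.exp 36) ^ 2 / ε ^ 4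
  filter_upwards [eventually_gt_atTop 0, eventually_ge_atTop ⌈C⌉₊] with R hR hC p hp
  have hR' : (1 : ℝ) ≤ R := by exact_mod_cast hR
  have hC' : C ≤ R := Nat.ceil_le.1 hC
  refine sum_trace_mat3_pow_le_of_bound hR hε ?_ hp
  calc 2 * (8 * R + 1 : ℝ) ^ R * (32 * Real.exp 36 * R) ^ (2 * R)
      ≤ 2 ^ R * (9 * R : ℝ) ^ R * (32 * Real.exp 36 * R) ^ (2 * R) := by
        gcongr
        · exact le_self_pow₀ (by norm_num) hR.ne'
        · linarith
    _ = (18 * (32 * Real.exp 36) ^ 2 * R ^ 3) ^ R := by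
        rw [pow_mul, ← mul_pow, ← mul_pow]
        ring
    _ ≤ (ε ^ 4 * R ^ 4) ^ R := by
        have : 18 * (32 * Real.exp 36) ^ 2 = C * ε ^ 4 := by
          simp only [C]; field_simp
        rw [this]
        gcongr ?_ ^ _
        calc C * ε ^ 4 * (R : ℝ) ^ 3 ≤ R * ε ^ 4 * (R : ℝ) ^ 3 := by gcongr
          _ = _ := by ring
    _ = _ := by rw [pow_mul, ← mul_pow]

/-! ### Spectral norm of the noise -/

namespace IsSBM

variable {Ω : Type*} [MeasurableSpace Ω] {μ : Measure Ω} [IsProbabilityMeasure μ]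
  {π₁ r w lam : ℝ} {n : ℕ} {A : Ω → Matrix (Fin n) (Fin n) ℝ}

/-- Markov's inequality for a high moment of the spectral norm of the noise. -/
theorem measure_noise_norm_le_of_moment (h : IsSBM μ π₁ r w lam n A) (hn : 0 < n) {t : ℝ}
    (ht : 0 < t) {p : ℕ} (hp : 0 < p) {V : ℝ}
    (hV : ∫ x, ((noise μ A x) ^ (2 * p)).trace ∂μ ≤ V) :
    μ.real {x | ¬ ∀ z, (noise μ A x *ᵥ z) ⬝ᵥ (noise μ A x *ᵥ z) ≤ t ^ 2 * (z ⬝ᵥ z)} ≤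
      V / t ^ (2 * p) := by
  have : Nonempty (Fin n) := ⟨⟨0, hn⟩⟩
  have hnn : ∀ x, 0 ≤ ((noise μ A x) ^ (2 * p)).trace := fun x => by
    rw [trace_pow_two_mul (h.noise_isSymm x)]
    exact Finset.sum_nonneg fun i _ => zero_le_dotProduct_self _
  have h1 := mul_meas_ge_le_integral_of_nonneg (ae_of_all μ hnn)
    (h.trace_noise_pow_integrable (2 * p)) (t ^ (2 * p))
  rw [le_div_iff₀ (by positivity), mul_comm]
  refine le_trans ?_ (h1.trans hV)
  refine mul_le_mul_of_nonneg_left (measureReal_mono fun x hx => ?_) (by positivity)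
  simp only [Set.mem_ofPred_eq] at hx ⊢
  by_contra! hlt
  refine hx fun z => ?_
  obtain ⟨ν, v, hv, hMv, hb⟩ := exists_eigenvector_norm_le (h.noise_isSymm x)
  have h2 := eigenvalue_pow_le_trace (h.noise_isSymm x) hv hMv p
  have h3 : (ν ^ 2) ^ p ≤ (t ^ 2) ^ p := by
    rw [← pow_mul, ← pow_mul]; exact h2.trans hlt.le
  have h4 : ν ^ 2 ≤ t ^ 2 := le_of_pow_le_pow_left₀ hp.ne' (by positivity) h3
  exact (hb z).trans (mul_le_mul_of_nonneg_right h4 (zero_le_dotProduct_self z))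

end IsSBM

/-- In the regime where the average degree is at least logarithmic, the spectral norm of the noise
is of smaller order than the average degree. -/
theorem eventually_measure_noise_norm_le {ε c : ℝ} (hε : 0 < ε) (hc : 0 < c) :
    ∀ᶠ n : ℕ in atTop, ∀ L : ℝ, c * Real.log n ≤ L → L / n ≤ 1 →
      ∀ (Ω : Type*) [MeasurableSpace Ω] (μ : Measure Ω) [IsProbabilityMeasure μ]
        (A : Ω → Matrix (Fin n) (Fin n) ℝ) (π₁ r w lam : ℝ), IsSBM μ π₁ r w lam n A →
        (∀ i j, expMatrix μ A i j ≤ L / n) →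
        μ.real {x | ¬ ∀ z, (noise μ A x *ᵥ z) ⬝ᵥ (noise μ A x *ᵥ z) ≤ (ε * L) ^ 2 * (z ⬝ᵥ z)} ≤
          2 / n := by
  -- Chosen so that the comparison size `⌈L⌉₊ + ⌈log n⌉₊` is at most `K * L`: the logarithm is at
  -- most `L / c`, and each of the two ceilings costs less than `1 ≤ L`.
  set K : ℝ := 3 + 1 / c
  have hK : 0 < K := by positivity
  have he := Real.exp_pos 1
  -- Dividing by `K` absorbs `R ≤ K * L`. The extra factor `exp 1` leaves the gain `exp (-2 * p) ≤
  -- n⁻¹ ^ 2` in Markov's inequality, which beats the factor `n` from the trace.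
  obtain ⟨R₀, hR₀⟩ := eventually_atTop.1
    (eventually_sum_trace_mat3_pow_le (ε := ε / (Real.exp 1 * K)) (by positivity))
  have hlog : Tendsto (fun n : ℕ => Real.log n) atTop atTop :=
    Real.tendsto_log_atTop.comp tendsto_natCast_atTop_atTop
  filter_upwards [eventually_gt_atTop 0, hlog.eventually_ge_atTop R₀, hlog.eventually_ge_atTop 1,
    hlog.eventually_ge_atTop (1 / c)] with n hn hlogR hlog1 hlogc
  intro L hL hL1 Ω _ μ _ A π₁ r w lam h hq
  have hn' : (0 : ℝ) < n := by exact_mod_cast hn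
  have hL1' : 1 ≤ L := by
    rw [div_le_iff₀ hc] at hlogc
    linarith
  have hL0 : 0 < L := by linarith
  set p := ⌈Real.log n⌉₊
  have hpl : Real.log n ≤ p := Nat.le_ceil _
  have hpu : (p : ℝ) < Real.log n + 1 := Nat.ceil_lt_add_one (by linarith)
  have hp : 0 < p := Nat.ceil_pos.2 (by linarith)
  set R := ⌈L⌉₊ + p
  have hR : L + p ≤ (R : ℕ) := by
    have := Nat.le_ceil L
    simp only [R]; push_cast; linarith
  have hRu : (R : ℝ) ≤ K * L := by
    have h1 : (⌈L⌉₊ : ℝ) < L + 1 := Nat.ceil_lt_add_one hL0.le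
    have h2 : Real.log n ≤ 1 / c * L := by
      rw [div_mul_eq_mul_div, one_mul, le_div_iff₀ hc]; linarith
    simp only [R, K]; push_cast; linarith
  have hR0 : 0 < R := by omega
  have hRR : R₀ ≤ R := by
    have : (R₀ : ℝ) ≤ R := by linarith
    exact_mod_cast this
  have h1 := h.integral_trace_noise_pow_le hL0.le hn hL1 hq hR hR0
  have h2 := hR₀ R hRR p (by omega)
  have hRp : (0 : ℝ) < R := by exact_mod_cast hR0
  have h3 : ∫ x, ((noise μ A x) ^ (2 * p)).trace ∂μ ≤
      2 * n * (ε * L / Real.exp 1) ^ (2 * p) := by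
    calc _ ≤ _ := h1
      _ ≤ (n / R : ℝ) * (2 * R * (ε / (Real.exp 1 * K) * R) ^ (2 * p)) := by gcongr
      _ = 2 * n * (ε / (Real.exp 1 * K) * R) ^ (2 * p) := by field_simp
      _ ≤ 2 * n * (ε / (Real.exp 1 * K) * (K * L)) ^ (2 * p) := by gcongr
      _ = _ := by
        congr 2
        field_simp
  refine (h.measure_noise_norm_le_of_moment hn (t := ε * L) (by positivity) hp h3).trans ?_
  have h4 : (n : ℝ) ^ 2 ≤ Real.exp 1 ^ (2 * p) := by
    rw [mul_comm 2 p, pow_mul]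
    gcongr
    rw [← Real.exp_nat_mul, mul_one]
    calc (n : ℝ) = Real.exp (Real.log n) := (Real.exp_log hn').symm
      _ ≤ _ := Real.exp_le_exp.2 hpl
  rw [div_pow, div_le_div_iff₀ (by positivity) hn']
  calc 2 * n * ((ε * L) ^ (2 * p) / Real.exp 1 ^ (2 * p)) * n
      = 2 * (ε * L) ^ (2 * p) * (n ^ 2 / Real.exp 1 ^ (2 * p)) := by ring
    _ ≤ 2 * (ε * L) ^ (2 * p) * 1 := by
        gcongr
        exact div_le_one_of_le₀ h4 (by positivity)
    _ = _ := by ring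

/-! ### Action of the noise on a fixed vector -/

/-- Second moment of a sum of random variables each of which is correlated only with itself and
with its image under `σ`. -/
theorem integral_sum_sq_le {Ω J : Type*} [MeasurableSpace Ω] {μ : Measure Ω} [Fintype J]
    [DecidableEq J] {X : J → Ω → ℝ} (σ : J → J) {c : J → ℝ} (hc : ∀ a, |c a| ≤ 1) {v : ℝ}
    (hv : 0 ≤ v) (hint : ∀ a b, Integrable (fun x => X a x * X b x) μ)
    (hX : ∀ a b, |∫ x, X a x * X b x ∂μ| ≤ if b = a ∨ b = σ a then v else 0) :
    ∫ x, (∑ a, c a * X a x) ^ 2 ∂μ ≤ 2 * v * Fintype.card J := by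
  have e : ∀ x, (∑ a, c a * X a x) ^ 2 = ∑ a, ∑ b, c a * c b * (X a x * X b x) := fun x => by
    rw [pow_two, Finset.sum_mul_sum]
    refine Finset.sum_congr rfl fun a _ => Finset.sum_congr rfl fun b _ => ?_
    ring
  simp_rw [e]
  rw [integral_finsetSum _ fun a _ => integrable_finsetSum _ fun b _ => (hint a b).const_mul _]
  calc _ ≤ ∑ _a : J, 2 * v := by
        refine Finset.sum_le_sum fun a _ => ?_
        rw [integral_finsetSum _ fun b _ => (hint a b).const_mul _]
        calc _ ≤ ∑ b, if b = a ∨ b = σ a then v else 0 := by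
              refine Finset.sum_le_sum fun b _ => ?_
              rw [integral_const_mul]
              refine (le_abs_self _).trans ?_
              rw [abs_mul, abs_mul]
              refine le_trans ?_ (hX a b)
              exact mul_le_of_le_one_left (abs_nonneg _)
                (mul_le_one₀ (hc a) (abs_nonneg _) (hc b))
          _ = ((Finset.univ.filter fun b => b = a ∨ b = σ a).card : ℝ) * v := by
              rw [← Finset.sum_filter, Finset.sum_const, nsmul_eq_mul]
          _ ≤ 2 * v := by
              gcongr
              have : (Finset.univ.filter fun b => b = a ∨ b = σ a) ⊆ {a, σ a} := fun b hb => by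
                simpa using hb
              exact_mod_cast (Finset.card_le_card this).trans Finset.card_le_two
    _ = _ := by rw [Finset.sum_const, Finset.card_univ, nsmul_eq_mul]; ring

/-- Chebyshev's inequality in terms of the second moment. -/
theorem measure_ge_le_of_integral_sq_le {Ω : Type*} [MeasurableSpace Ω] {μ : Measure Ω}
    [IsFiniteMeasure μ] {S : Ω → ℝ} (hS : Integrable (fun x => S x ^ 2) μ) {t V : ℝ} (ht : 0 < t)
    (hV : ∫ x, S x ^ 2 ∂μ ≤ V) : μ.real {x | t ≤ S x} ≤ V / t ^ 2 := by
  rw [le_div_iff₀ (by positivity), mul_comm]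
  refine le_trans ?_ ((mul_meas_ge_le_integral_of_nonneg
    (ae_of_all μ fun x => sq_nonneg (S x)) hS (t ^ 2)).trans hV)
  refine mul_le_mul_of_nonneg_left (measureReal_mono fun x hx => ?_) (by positivity)
  simp only [Set.mem_ofPred_eq] at hx ⊢
  gcongr

namespace IsSBM

variable {Ω : Type*} [MeasurableSpace Ω] {μ : Measure Ω} [IsProbabilityMeasure μ]
  {π₁ r w lam : ℝ} {n : ℕ} {A : Ω → Matrix (Fin n) (Fin n) ℝ}

theorem abs_integral_prod_noise_le {J : Type*} [Fintype J] (h : IsSBM μ π₁ r w lam n A) {q : ℝ}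
    (hq1 : q ≤ 1) (hq : ∀ i j, expMatrix μ A i j ≤ q) (z : J → Sym2 (Fin n))
    (hz : ∀ j, ¬ (z j).IsDiag) {m : ℕ} (hm : m ≤ (Finset.univ.image z).card) (hq0 : 0 ≤ q) :
    |∫ x, ∏ j, noise μ A x (z j).inf (z j).sup ∂μ| ≤ q ^ m := by
  rw [h.integral_prod_noise z hz, Finset.abs_prod]
  refine le_trans ?_ (pow_le_pow_of_le_one hq0 hq1 hm)
  rw [← Finset.prod_const]
  refine Finset.prod_le_prod (fun e _ => abs_nonneg _) fun e he => ?_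
  obtain ⟨i, -, hi⟩ := Finset.mem_image.1 he
  exact (h.abs_integral_noise_pow_le_exp _ _ (Finset.card_pos.2 ⟨i, by simp [hi]⟩)).trans (hq _ _)

/-- An edge that occurs exactly once contributes its mean, which is zero. -/
theorem integral_prod_noise_eq_zero {J : Type*} [Fintype J] (h : IsSBM μ π₁ r w lam n A)
    (z : J → Sym2 (Fin n)) (hz : ∀ j, ¬ (z j).IsDiag) (j₀ : J) (h₀ : ∀ j, z j = z j₀ → j = j₀) :
    ∫ x, ∏ j, noise μ A x (z j).inf (z j).sup ∂μ = 0 := by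
  rw [h.integral_prod_noise z hz]
  refine Finset.prod_eq_zero (Finset.mem_image_of_mem z (Finset.mem_univ j₀)) ?_
  have : (Finset.univ.filter fun j => z j = z j₀) = {j₀} := by
    ext j
    simp only [Finset.mem_filter, Finset.mem_univ, true_and, Finset.mem_singleton]
    exact ⟨h₀ j, fun hj => by rw [hj]⟩
  rw [this, Finset.card_singleton]
  simp only [pow_one]
  exact h.integral_noise _ _

/-- Two entries of the noise are uncorrelated unless they belong to the same edge. -/
theorem abs_integral_noise_mul_noise_le (h : IsSBM μ π₁ r w lam n A) {q : ℝ} (hq1 : q ≤ 1)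
    (hq0 : 0 ≤ q) (hq : ∀ i j, expMatrix μ A i j ≤ q) (a b : Fin n × Fin n) :
    |∫ x, noise μ A x a.1 a.2 * noise μ A x b.1 b.2 ∂μ| ≤ if b = a ∨ b = a.swap then q else 0 := by
  by_cases ha : a.1 = a.2
  · have : ∀ x, noise μ A x a.1 a.2 = 0 := fun x => by rw [ha, h.noise_diag]
    simp only [this, zero_mul, integral_zero, abs_zero]
    split_ifs <;> linarith
  by_cases hb : b.1 = b.2
  · have : ∀ x, noise μ A x b.1 b.2 = 0 := fun x => by rw [hb, h.noise_diag]
    simp only [this, mul_zero, integral_zero, abs_zero]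
    split_ifs <;> linarith
  let z : Fin 2 → Sym2 (Fin n) := ![s(a.1, a.2), s(b.1, b.2)]
  have hz : ∀ j, ¬ (z j).IsDiag := by
    intro j
    fin_cases j <;> simpa [z]
  have e : ∀ x, noise μ A x a.1 a.2 * noise μ A x b.1 b.2 =
      ∏ j, noise μ A x (z j).inf (z j).sup := fun x => by
    rw [h.noise_eq_inf_sup x a.1, h.noise_eq_inf_sup x b.1, Fin.prod_univ_two]
    rfl
  simp_rw [e]
  split_ifs with hab
  · have := h.abs_integral_prod_noise_le hq1 hq z hz (m := 1)
      (Finset.card_pos.2 ⟨z 0, Finset.mem_image_of_mem z (Finset.mem_univ 0)⟩) hq0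
    rwa [pow_one] at this
  · have hne : z 1 ≠ z 0 := by
      intro heq
      simp only [z, Matrix.cons_val_one, Matrix.cons_val_zero, Sym2.eq_iff] at heq
      refine hab ?_
      simpa [Prod.ext_iff] using heq
    rw [h.integral_prod_noise_eq_zero z hz 0 fun j hj => ?_, abs_zero]
    fin_cases j
    · rfl
    · exact absurd hj hne

/-- Products of two entries of the noise in the same row are essentially uncorrelated. -/
theorem abs_integral_noise_pairs_le (h : IsSBM μ π₁ r w lam n A) {q : ℝ} (hq1 : q ≤ 1)
    (hq0 : 0 ≤ q) (hq : ∀ i j, expMatrix μ A i j ≤ q) (a b : Fin n × Fin n × Fin n)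
    (ha : a.2.1 ≠ a.2.2) (hb : b.2.1 ≠ b.2.2) :
    |∫ x, (noise μ A x a.1 a.2.1 * noise μ A x a.1 a.2.2) *
      (noise μ A x b.1 b.2.1 * noise μ A x b.1 b.2.2) ∂μ| ≤
      if b = a ∨ b = (a.1, a.2.swap) then q ^ 2 else 0 := by
  have hr : (0 : ℝ) ≤ if b = a ∨ b = (a.1, a.2.swap) then q ^ 2 else 0 := by
    split_ifs <;> positivity
  obtain ⟨i, j, k⟩ := a
  obtain ⟨i', j', k'⟩ := b
  simp only at ha hb hr ⊢
  by_cases hd : i = j ∨ i = k ∨ i' = j' ∨ i' = k'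
  · have : ∀ x, (noise μ A x i j * noise μ A x i k) *
        (noise μ A x i' j' * noise μ A x i' k') = 0 := fun x => by
      rcases hd with hd | hd | hd | hd <;> simp [hd, h.noise_diag]
    simp only [this, integral_zero, abs_zero]
    exact hr
  push Not at hd
  obtain ⟨h1, h2, h3, h4⟩ := hd
  let z : Fin 4 → Sym2 (Fin n) := ![s(i, j), s(i, k), s(i', j'), s(i', k')]
  have hz : ∀ j, ¬ (z j).IsDiag := by
    intro j
    fin_cases j <;> simpa [z]
  have e : ∀ x, (noise μ A x i j * noise μ A x i k) *
        (noise μ A x i' j' * noise μ A x i' k') =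
      ∏ j, noise μ A x (z j).inf (z j).sup := fun x => by
    rw [h.noise_eq_inf_sup x i j, h.noise_eq_inf_sup x i k, h.noise_eq_inf_sup x i' j',
      h.noise_eq_inf_sup x i' k', Fin.prod_univ_four]
    simp only [z, Matrix.cons_val, mul_assoc]
  simp_rw [e]
  have h01 : z 1 ≠ z 0 := by
    simp only [z, Matrix.cons_val, ne_eq, Sym2.eq_iff]
    grind
  have h23 : z 2 ≠ z 3 := by
    simp only [z, Matrix.cons_val, ne_eq, Sym2.eq_iff]
    grind
  split_ifs with hab
  · refine h.abs_integral_prod_noise_le hq1 hq z hz ?_ hq0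
    rw [← Finset.card_pair h01]
    refine Finset.card_le_card fun e he => ?_
    simp only [Finset.mem_insert, Finset.mem_singleton] at he
    rcases he with rfl | rfl <;> exact Finset.mem_image_of_mem z (Finset.mem_univ _)
  · rw [abs_nonpos_iff]
    -- If both edges of the first pair are matched in the second, the two pairs of edges agree. Two
    -- distinct edges share at most one node, so the centres agree too, which is the excluded case.
    -- Otherwise some edge occurs only once and the expectation vanishes.
    by_cases hA : z 2 = z 0 ∨ z 3 = z 0
    · by_cases hB : z 2 = z 1 ∨ z 3 = z 1
      · exfalso
        apply hab
        simp only [z, Matrix.cons_val, Sym2.eq_iff, Prod.mk.injEq, Prod.swap] at hA hB h01 h23 ⊢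
        grind
      · push Not at hB
        refine h.integral_prod_noise_eq_zero z hz 1 fun j hj => ?_
        fin_cases j
        · exact absurd hj.symm h01
        · rfl
        · exact absurd hj hB.1
        · exact absurd hj hB.2
    · push Not at hA
      refine h.integral_prod_noise_eq_zero z hz 0 fun j hj => ?_
      fin_cases j
      · rfl
      · exact absurd hj h01
      · exact absurd hj hA.1
      · exact absurd hj hA.2

/-- Concentration of the action of the noise on a fixed bounded vector. -/
theorem measure_noise_mulVec_sq_le (h : IsSBM μ π₁ r w lam n A) (hn : 0 < n) {L : ℝ} (hL : 1 ≤ L)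
    (hL1 : L / n ≤ 1) (hq : ∀ i j, expMatrix μ A i j ≤ L / n) {b : Fin n → ℝ}
    (hb : ∀ i, |b i| ≤ 1) :
    μ.real {x | ¬ (noise μ A x *ᵥ b) ⬝ᵥ (noise μ A x *ᵥ b) ≤ 4 * n * L} ≤ 4 / n := by
  have hn' : (0 : ℝ) < n := by exact_mod_cast hn
  have hq0 : 0 ≤ L / n := by positivity
  -- The squared length of the noise applied to `b` is a diagonal part, controlled by the linear sum
  -- `S`, plus the off-diagonal part `T`. Each is below `n * L` by Chebyshev outside an event of
  -- probability at most `2 / n`; the mean of the diagonal costs the remaining `2 * n * L`.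
  let S : Ω → ℝ := fun x => ∑ a : Fin n × Fin n, 1 * noise μ A x a.1 a.2
  let X : Fin n × Fin n × Fin n → Ω → ℝ := fun a x =>
    if a.2.1 = a.2.2 then 0 else noise μ A x a.1 a.2.1 * noise μ A x a.1 a.2.2
  let T : Ω → ℝ := fun x => ∑ a : Fin n × Fin n × Fin n, (b a.2.1 * b a.2.2) * X a x
  have hXb : ∀ a x, |X a x| ≤ 1 := fun a x => by
    simp only [X]
    split_ifs
    · simp
    · rw [abs_mul]
      exact mul_le_one₀ (h.abs_noise_le_one _ _ _) (abs_nonneg _) (h.abs_noise_le_one _ _ _)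
  have hXm : ∀ a, Measurable (X a) := fun a => by
    simp only [X]
    split_ifs
    · exact measurable_const
    · exact (h.noise_measurable _ _).mul (h.noise_measurable _ _)
  have hXi : ∀ a c, Integrable (fun x => X a x * X c x) μ := fun a c => by
    refine Integrable.of_bound ((hXm a).mul (hXm c)).aestronglyMeasurable 1
      (ae_of_all _ fun x => ?_)
    rw [Real.norm_eq_abs, abs_mul]
    exact mul_le_one₀ (hXb a x) (abs_nonneg _) (hXb c x)
  have hSi : ∀ a c : Fin n × Fin n,
      Integrable (fun x => noise μ A x a.1 a.2 * noise μ A x c.1 c.2) μ := fun a c => by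
    refine Integrable.of_bound
      ((h.noise_measurable _ _).mul (h.noise_measurable _ _)).aestronglyMeasurable 1
      (ae_of_all _ fun x => ?_)
    rw [Real.norm_eq_abs, abs_mul]
    exact mul_le_one₀ (h.abs_noise_le_one _ _ _) (abs_nonneg _) (h.abs_noise_le_one _ _ _)
  have sq_int : ∀ {J : Type} [Fintype J] (c : J → ℝ) (Y : J → Ω → ℝ)
      (_ : ∀ a d, Integrable (fun x => Y a x * Y d x) μ),
      Integrable (fun x => (∑ a, c a * Y a x) ^ 2) μ := by
    intro J _ c Y hY
    have e : ∀ x, (∑ a, c a * Y a x) ^ 2 = ∑ a, ∑ d, c a * c d * (Y a x * Y d x) := fun x => by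
      rw [pow_two, Finset.sum_mul_sum]
      refine Finset.sum_congr rfl fun a _ => Finset.sum_congr rfl fun b _ => ?_
      ring
    simp_rw [e]
    exact integrable_finsetSum _ fun a _ => integrable_finsetSum _ fun d _ => (hY a d).const_mul _
  have hS : ∫ x, S x ^ 2 ∂μ ≤ 2 * (L / n) * Fintype.card (Fin n × Fin n) :=
    integral_sum_sq_le Prod.swap (fun _ => by simp) hq0 hSi
      (h.abs_integral_noise_mul_noise_le hL1 hq0 hq)
  have hT : ∫ x, T x ^ 2 ∂μ ≤ 2 * (L / n) ^ 2 * Fintype.card (Fin n × Fin n × Fin n) := by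
    refine integral_sum_sq_le (fun a => (a.1, a.2.swap)) (fun a => ?_) (by positivity) hXi ?_
    · rw [abs_mul]
      exact mul_le_one₀ (hb _) (abs_nonneg _) (hb _)
    · intro a c
      have hr : (0 : ℝ) ≤ if c = a ∨ c = (a.1, a.2.swap) then (L / n) ^ 2 else 0 := by
        split_ifs <;> positivity
      by_cases ha : a.2.1 = a.2.2
      · simpa [X, ha] using hr
      by_cases hc : c.2.1 = c.2.2
      · simpa [X, hc] using hr
      simp only [X, if_neg ha, if_neg hc]
      exact h.abs_integral_noise_pairs_le hL1 hq0 hq a c ha hc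
  have hnL : 0 < n * L := by positivity
  have hS' := measure_ge_le_of_integral_sq_le (sq_int _ _ hSi) hnL hS
  have hT' := measure_ge_le_of_integral_sq_le (sq_int _ _ hXi) hnL hT
  have e1 : 2 * (L / n) * Fintype.card (Fin n × Fin n) / (n * L) ^ 2 ≤ 2 / n := by
    rw [Fintype.card_prod, Fintype.card_fin]
    push_cast
    rw [div_le_div_iff₀ (by positivity) hn']
    field_simp
    exact hL
  have e2 : 2 * (L / n) ^ 2 * Fintype.card (Fin n × Fin n × Fin n) / (n * L) ^ 2 ≤ 2 / n := by
    rw [Fintype.card_prod, Fintype.card_prod, Fintype.card_fin]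
    push_cast
    refine le_of_eq ?_
    field_simp
  have key : {x | ¬ (noise μ A x *ᵥ b) ⬝ᵥ (noise μ A x *ᵥ b) ≤ 4 * n * L} ⊆
      {x | n * L ≤ S x} ∪ {x | n * L ≤ T x} := by
    intro x hx
    simp only [Set.mem_union, Set.mem_ofPred_eq, not_le] at hx ⊢
    by_contra! hlt
    obtain ⟨hs, ht⟩ := hlt
    have f1 : (noise μ A x *ᵥ b) ⬝ᵥ (noise μ A x *ᵥ b) =
        (∑ i, ∑ j, b j ^ 2 * noise μ A x i j ^ 2) + T x := by
      simp only [T, X, dotProduct, mulVec, Fintype.sum_prod_type]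
      rw [← Finset.sum_add_distrib]
      refine Finset.sum_congr rfl fun i _ => ?_
      rw [Finset.sum_mul_sum, ← Finset.sum_add_distrib]
      refine Finset.sum_congr rfl fun j _ => ?_
      rw [← Finset.add_sum_erase _ _ (Finset.mem_univ j),
        ← Finset.add_sum_erase (a := j) Finset.univ (fun k => b j * b k * _) (Finset.mem_univ j)]
      simp only [if_true, mul_zero, zero_add]
      congr 1
      · ring
      · refine Finset.sum_congr rfl fun k hk => ?_
        rw [if_neg (Finset.ne_of_mem_erase hk).symm]
        ring
    have f2 : ∑ i, ∑ j, b j ^ 2 * noise μ A x i j ^ 2 ≤ S x + 2 * (n * L) := by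
      calc _ ≤ ∑ i : Fin n, ∑ j : Fin n, (noise μ A x i j + 2 * (L / n)) := by
            refine Finset.sum_le_sum fun i _ => Finset.sum_le_sum fun j _ => ?_
            have hb2 : b j ^ 2 ≤ 1 := (sq_le_one_iff_abs_le_one _).2 (hb j)
            -- Because the entry is Bernoulli, its centred square is bounded by an affine function
            -- of itself; fourth moments are thereby avoided.
            have g1 : noise μ A x i j ^ 2 ≤ noise μ A x i j + 2 * (L / n) := by
              obtain ⟨g0, g2⟩ := h.expMatrix_apply_mem i j
              have g3 := hq i j
              simp only [noise, Matrix.sub_apply]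
              rcases h.zero_or_one x i j with g | g <;> rw [g] <;> nlinarith
            nlinarith [sq_nonneg (noise μ A x i j)]
        _ = _ := by
            simp only [S, Finset.sum_add_distrib, Fintype.sum_prod_type, one_mul,
              Finset.sum_const, Finset.card_univ, Fintype.card_fin, nsmul_eq_mul]
            field_simp
    rw [f1] at hx
    linarith
  calc _ ≤ μ.real ({x | n * L ≤ S x} ∪ {x | n * L ≤ T x}) := measureReal_mono key
    _ ≤ μ.real {x | n * L ≤ S x} + μ.real {x | n * L ≤ T x} := measureReal_union_le _ _
    _ ≤ 2 / n + 2 / n := add_le_add (hS'.trans e1) (hT'.trans e2)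
    _ = _ := by ring

end IsSBM

/-! ### Euclidean norms and leading eigenvalues -/

/-- The Euclidean norm of a vector. -/
noncomputable def vnorm {α : Type*} [Fintype α] (x : α → ℝ) : ℝ := ‖WithLp.toLp 2 x‖

section vnorm

variable {α : Type*} [Fintype α]

theorem vnorm_sq (x : α → ℝ) : vnorm x ^ 2 = x ⬝ᵥ x := norm_toLp_sq x

theorem vnorm_nonneg (x : α → ℝ) : 0 ≤ vnorm x := norm_nonneg _

theorem vnorm_add_le (x y : α → ℝ) : vnorm (x + y) ≤ vnorm x + vnorm y := by
  simpa [vnorm] using norm_add_le (WithLp.toLp 2 x) (WithLp.toLp 2 y)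

theorem vnorm_sub_le (x y : α → ℝ) : vnorm (x - y) ≤ vnorm x + vnorm y := by
  simpa [vnorm] using norm_sub_le (WithLp.toLp 2 x) (WithLp.toLp 2 y)

theorem vnorm_smul (a : ℝ) (x : α → ℝ) : vnorm (a • x) = |a| * vnorm x := by
  simp [vnorm, norm_smul]

theorem abs_dotProduct_le (x y : α → ℝ) : |x ⬝ᵥ y| ≤ vnorm x * vnorm y := by
  refine abs_le_of_sq_le_sq ?_ (mul_nonneg (vnorm_nonneg _) (vnorm_nonneg _))
  rw [mul_pow, vnorm_sq, vnorm_sq]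
  exact dotProduct_sq_le x y

theorem vnorm_le_of_dotProduct_le {x y : α → ℝ} {a : ℝ} (ha : 0 ≤ a)
    (h : x ⬝ᵥ x ≤ a ^ 2 * (y ⬝ᵥ y)) : vnorm x ≤ a * vnorm y := by
  refine le_of_sq_le_sq ?_ (mul_nonneg ha (vnorm_nonneg _))
  rwa [mul_pow, vnorm_sq, vnorm_sq]

theorem vnorm_eq_one {x : α → ℝ} (h : x ⬝ᵥ x = 1) : vnorm x = 1 := by
  rw [← vnorm_sq] at h
  exact (pow_eq_one_iff_of_nonneg (vnorm_nonneg x) two_ne_zero).1 h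

theorem vnorm_pos {x : α → ℝ} (h : x ≠ 0) : 0 < vnorm x := by
  have := dotProduct_self_pos_of_ne_zero h
  rw [← vnorm_sq] at this
  exact (vnorm_nonneg x).lt_of_ne fun h0 => by rw [← h0] at this; norm_num at this

end vnorm

/-- A leading pair has large eigenvalues if the matrix is bounded below on a space which meets
every hyperplane. -/
theorem le_abs_eigenvalue {n : ℕ} {M : Matrix (Fin n) (Fin n) ℝ} (hM : M.IsSymm)
    {U : Matrix (Fin 2) (Fin n) ℝ} (hU : U * Uᵀ = 1) {ρ : Fin 2 → ℝ}
    (hρ : ∀ k, M *ᵥ U k = ρ k • U k)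
    (hlead : ∀ (ν : ℝ) (v : Fin n → ℝ), v ≠ 0 → M *ᵥ v = ν • v → (∀ k, U k ⬝ᵥ v = 0) →
      ∀ k, |ν| ≤ |ρ k|) {τ : ℝ}
    (hτ : ∀ u : Fin n → ℝ, ∃ w : Fin n → ℝ, w ≠ 0 ∧ u ⬝ᵥ w = 0 ∧
      τ * vnorm w ≤ vnorm (M *ᵥ w)) (k : Fin 2) :
    τ ≤ |ρ k| := by
  obtain ⟨l, hl⟩ : ∃ l : Fin 2, ∀ j, j = k ∨ j = l := by
    refine ⟨1 - k, ?_⟩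
    fin_cases k <;> decide
  obtain ⟨w, hw0, hlw, hw⟩ := hτ (U l)
  have hll : U l ⬝ᵥ U l = 1 := by simpa [Matrix.mul_apply, dotProduct] using congr_fun₂ hU l l
  -- Deflation by the other row. Eigenvectors of `B` with nonzero eigenvalue are orthogonal to `U
  -- l`, hence are eigenvectors of `M`; either they are orthogonal to both rows or their eigenvalue
  -- is `ρ k`. So `B` has norm at most `|ρ k|`, and it agrees with `M` on the test vector orthogonal
  -- to `U l`.
  set B : Matrix (Fin n) (Fin n) ℝ := M - ρ l • vecMulVec (U l) (U l)
  have hB : B.IsSymm := by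
    refine hM.sub ?_
    ext i j
    simp [vecMulVec_apply, mul_comm]
  have hBv : ∀ v, B *ᵥ v = M *ᵥ v - (ρ l * (U l ⬝ᵥ v)) • U l := fun v => by
    simp only [B, sub_mulVec, smul_mulVec, vecMulVec_mulVec]
    congr 1
    ext i
    simp
    ring
  have hev : ∀ (ν : ℝ) (v : Fin n → ℝ), v ≠ 0 → B *ᵥ v = ν • v → |ν| ≤ |ρ k| := by
    intro ν v hv hνv
    rcases eq_or_ne ν 0 with rfl | hν
    · simp
    have h1 : U l ⬝ᵥ v = 0 := by
      have h2 : U l ⬝ᵥ B *ᵥ v = 0 := by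
        rw [dotProduct_mulVec_comm hB, hBv, hρ, hll]
        simp
      rw [hνv, dotProduct_smul, smul_eq_mul] at h2
      exact (mul_eq_zero.1 h2).resolve_left hν
    have h3 : M *ᵥ v = ν • v := by
      rw [← hνv, hBv, h1]; simp
    by_cases h4 : U k ⬝ᵥ v = 0
    · exact hlead ν v hv h3 (fun j => by rcases hl j with rfl | rfl <;> assumption) k
    · have h5 : U k ⬝ᵥ M *ᵥ v = ρ k * (U k ⬝ᵥ v) := by
        rw [dotProduct_mulVec_comm hM, hρ, smul_dotProduct, smul_eq_mul]
      rw [h3, dotProduct_smul, smul_eq_mul] at h5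
      rw [mul_right_cancel₀ h4 h5]
  have h6 : vnorm (M *ᵥ w) ≤ |ρ k| * vnorm w := by
    have h7 : B *ᵥ w = M *ᵥ w := by rw [hBv, hlw]; simp
    rw [← h7]
    exact vnorm_le_of_dotProduct_le (abs_nonneg _) (mulVec_sq_le_of_eigenvalues_le hB hev w)
  exact le_of_mul_le_mul_right (hw.trans h6) (vnorm_pos hw0)

/-! ### Block vectors, signal and perturbation of eigenvectors -/

section Blocks

variable {n : ℕ} (c : Fin n → Fin 2)

/-- The vector which is constant on the communities. -/
def blockVec (f : Fin 2 → ℝ) : Fin n → ℝ := fun i => f (c i)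

/-- The number of nodes of a community. -/
def blockSize (a : Fin 2) : ℝ := (Finset.univ.filter fun i => c i = a).card

theorem sum_blockVec (f : Fin 2 → ℝ) :
    ∑ i, f (c i) = blockSize c 0 * f 0 + blockSize c 1 * f 1 := by
  rw [← Finset.sum_fiberwise (s := Finset.univ) (g := c), Fin.sum_univ_two]
  have : ∀ a, ∑ i with c i = a, f (c i) = blockSize c a * f a := fun a => by
    rw [Finset.sum_congr rfl (g := fun _ => f a) fun i hi => by rw [(Finset.mem_filter.1 hi).2],
      Finset.sum_const, nsmul_eq_mul, blockSize]
  rw [this, this]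

theorem blockSize_add : blockSize c 0 + blockSize c 1 = n := by
  have := sum_blockVec c fun _ => 1
  simpa using this.symm

theorem blockVec_dotProduct (f g : Fin 2 → ℝ) : blockVec c f ⬝ᵥ blockVec c g =
    blockSize c 0 * (f 0 * g 0) + blockSize c 1 * (f 1 * g 1) :=
  sum_blockVec c fun a => f a * g a

theorem blockVec_dotProduct_one (f : Fin 2 → ℝ) : blockVec c f ⬝ᵥ 1 =
    blockSize c 0 * f 0 + blockSize c 1 * f 1 := by
  rw [dotProduct_one]
  exact sum_blockVec c f

/-- The matrix of connection probabilities, without removal of the diagonal. -/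
noncomputable def signal (r w lam : ℝ) : Matrix (Fin n) (Fin n) ℝ :=
  Matrix.of fun i j => blockProb r w lam n (c i) (c j)

theorem signal_mulVec (r w lam : ℝ) (v : Fin n → ℝ) :
    ∃ f, signal c r w lam *ᵥ v = blockVec c f :=
  ⟨fun a => ∑ j, blockProb r w lam n a (c j) * v j, rfl⟩

theorem signal_mulVec_blockVec (r w lam : ℝ) (f : Fin 2 → ℝ) :
    signal c r w lam *ᵥ blockVec c f =
      blockVec c fun a => blockSize c 0 * (blockProb r w lam n a 0 * f 0) +
        blockSize c 1 * (blockProb r w lam n a 1 * f 1) := by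
  ext i
  exact sum_blockVec c fun b => blockProb r w lam n (c i) b * f b

/-- The constant in the lower bound for the signal. -/
noncomputable def signalConst (κ r w : ℝ) : ℝ := κ * |w - r ^ 2| / √(1 + 2 * r ^ 2 + w ^ 2)

theorem signalConst_pos {κ r w : ℝ} (hκ : 0 < κ) (h : w ≠ r ^ 2) : 0 < signalConst κ r w := by
  have := abs_pos.2 (sub_ne_zero.2 h)
  unfold signalConst
  positivity

/-- In coordinates weighted by community sizes, the signal acts as `lam / n` times the matrix with
rows `(1, r)` and `(r, w)`, whose smallest singular value is at least its determinant in absolute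
value over its Frobenius norm. The two changes of weights contribute one factor `κ * n` each to the
squared norm. -/
theorem le_vnorm_signal_mulVec {κ r w lam : ℝ} (hκ : 0 < κ) (hn : 0 < n)
    (hc : ∀ a, κ * n ≤ blockSize c a) (f : Fin 2 → ℝ) :
    signalConst κ r w * lam * vnorm (blockVec c f) ≤
      vnorm (signal c r w lam *ᵥ blockVec c f) := by
  have hn' : (0 : ℝ) < n := by exact_mod_cast hn
  refine le_of_sq_le_sq ?_ (vnorm_nonneg _)
  rw [mul_pow, mul_pow, vnorm_sq, vnorm_sq, signal_mulVec_blockVec, blockVec_dotProduct,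
    blockVec_dotProduct]
  set m₀ := blockSize c 0
  set m₁ := blockSize c 1
  have h0 : κ * n ≤ m₀ := hc 0
  have h1 : κ * n ≤ m₁ := hc 1
  have hs : signalConst κ r w ^ 2 = κ ^ 2 * (w - r ^ 2) ^ 2 / (1 + 2 * r ^ 2 + w ^ 2) := by
    rw [signalConst, div_pow, mul_pow, sq_abs, Real.sq_sqrt (by positivity)]
  have hb : ∀ x y : ℝ, m₀ * (blockProb r w lam n 0 0 * x) + m₁ * (blockProb r w lam n 0 1 * y) =
      lam / n * (m₀ * x + r * (m₁ * y)) := fun x y => by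
    simp [blockProb]; ring
  have hb' : ∀ x y : ℝ, m₀ * (blockProb r w lam n 1 0 * x) + m₁ * (blockProb r w lam n 1 1 * y) =
      lam / n * (r * (m₀ * x) + w * (m₁ * y)) := fun x y => by
    simp [blockProb]; ring
  rw [hb, hb', hs]
  generalize hx : f 0 = x
  generalize hy : f 1 = y
  set X := m₀ * x
  set Y := m₁ * y
  set p := X + r * Y
  set q := r * X + w * Y
  have hκn : 0 < κ * n := by positivity
  have hm0 : 0 < m₀ := hκn.trans_le h0
  have hm1 : 0 < m₁ := hκn.trans_le h1
  have key : (w - r ^ 2) ^ 2 * (X ^ 2 + Y ^ 2) ≤ (1 + 2 * r ^ 2 + w ^ 2) * (p ^ 2 + q ^ 2) := by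
    have e1 : (w - r ^ 2) * X = w * p - r * q := by simp only [p, q]; ring
    have e2 : (w - r ^ 2) * Y = q - r * p := by simp only [p, q]; ring
    calc _ = ((w - r ^ 2) * X) ^ 2 + ((w - r ^ 2) * Y) ^ 2 := by ring
      _ ≤ _ := by
        rw [e1, e2]
        nlinarith [sq_nonneg (w * q + r * p), sq_nonneg (p + r * q), sq_nonneg (r * q),
          sq_nonneg (r * p)]
  have g1 : κ * n * (m₀ * (x * x)) ≤ X ^ 2 := by
    simp only [X]
    nlinarith [mul_le_mul_of_nonneg_right h0 (mul_nonneg hm0.le (mul_self_nonneg x))]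
  have g2 : κ * n * (m₁ * (y * y)) ≤ Y ^ 2 := by
    simp only [Y]
    nlinarith [mul_le_mul_of_nonneg_right h1 (mul_nonneg hm1.le (mul_self_nonneg y))]
  have hD : 0 < 1 + 2 * r ^ 2 + w ^ 2 := by positivity
  calc κ ^ 2 * (w - r ^ 2) ^ 2 / (1 + 2 * r ^ 2 + w ^ 2) * lam ^ 2 *
        (m₀ * (x * x) + m₁ * (y * y))
      = κ * lam ^ 2 / n / (1 + 2 * r ^ 2 + w ^ 2) * ((w - r ^ 2) ^ 2 *
        (κ * n * (m₀ * (x * x)) + κ * n * (m₁ * (y * y)))) := by field_simp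
    _ ≤ κ * lam ^ 2 / n / (1 + 2 * r ^ 2 + w ^ 2) * ((w - r ^ 2) ^ 2 * (X ^ 2 + Y ^ 2)) := by
        gcongr
    _ ≤ κ * lam ^ 2 / n / (1 + 2 * r ^ 2 + w ^ 2) *
        ((1 + 2 * r ^ 2 + w ^ 2) * (p ^ 2 + q ^ 2)) := by gcongr
    _ = κ * n * (lam / n * p * (lam / n * p)) + κ * n * (lam / n * q * (lam / n * q)) := by
        field_simp
    _ ≤ _ := by
        have := mul_self_nonneg (lam / n * p)
        have := mul_self_nonneg (lam / n * q)
        gcongr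

theorem exists_blockVec_orthogonal (hc : ∀ a, 0 < blockSize c a) (u : Fin n → ℝ) :
    ∃ f, blockVec c f ≠ 0 ∧ u ⬝ᵥ blockVec c f = 0 := by
  have hne : ∀ f : Fin 2 → ℝ, f ≠ 0 → blockVec c f ≠ 0 := by
    intro f hf h0
    apply hf
    ext a
    have hca := hc a
    unfold blockSize at hca
    have : 0 < (Finset.univ.filter fun i => c i = a).card := by exact_mod_cast hca
    obtain ⟨i, hi⟩ := Finset.card_pos.1 this
    rw [← (Finset.mem_filter.1 hi).2]
    exact congrFun h0 i
  have hd : ∀ f : Fin 2 → ℝ, u ⬝ᵥ blockVec c f =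
      (∑ i with c i = 0, u i) * f 0 + (∑ i with c i = 1, u i) * f 1 := by
    intro f
    rw [dotProduct, ← Finset.sum_fiberwise (s := Finset.univ) (g := c), Fin.sum_univ_two]
    simp only [Finset.sum_mul]
    congr 1 <;> refine Finset.sum_congr rfl fun i hi => ?_ <;>
      rw [blockVec, (Finset.mem_filter.1 hi).2]
  set α := ∑ i with c i = 0, u i
  set β := ∑ i with c i = 1, u i
  by_cases h : α = 0 ∧ β = 0
  · refine ⟨fun _ => 1, hne _ fun h0 => one_ne_zero (congrFun h0 0), ?_⟩
    rw [hd, h.1, h.2]; simp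
  · refine ⟨![β, -α], hne _ fun h0 => h ?_, ?_⟩
    · have h1 := congrFun h0 0
      have h2 := congrFun h0 1
      simp at h1 h2
      exact ⟨h2, h1⟩
    · rw [hd]; simp; ring

/-- An eigenvector of a perturbation of the signal is close to a block vector. -/
theorem exists_blockVec_close {r w lam : ℝ} {M F : Matrix (Fin n) (Fin n) ℝ}
    (hMF : M = signal c r w lam + F) {ρ τ : ℝ} (hτ : 0 < τ) (hρ : τ ≤ |ρ|)
    (hF : ∀ x, vnorm (F *ᵥ x) ≤ τ / 2 * vnorm x) {η : ℝ} (hη : 0 ≤ η)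
    (hFb : ∀ f, vnorm (F *ᵥ blockVec c f) ≤ η * vnorm (blockVec c f)) {v : Fin n → ℝ}
    (hv : vnorm v = 1) (hMv : M *ᵥ v = ρ • v) :
    ∃ f, vnorm (v - blockVec c f) ≤ 3 * η / τ := by
  obtain ⟨g, hg⟩ := signal_mulVec c r w lam v
  have hρ0 : ρ ≠ 0 := by
    rintro rfl
    rw [abs_zero] at hρ
    linarith
  refine ⟨ρ⁻¹ • g, ?_⟩
  set x := blockVec c (ρ⁻¹ • g) with hx
  have hxg : ρ • x = signal c r w lam *ᵥ v := by
    rw [hg, hx]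
    ext i
    simp [blockVec, hρ0]
  have h1 : ρ • (v - x) = F *ᵥ v := by
    rw [smul_sub, hxg, ← hMv, hMF, add_mulVec]
    abel
  have h2 : |ρ| * vnorm (v - x) = vnorm (F *ᵥ v) := by rw [← vnorm_smul, h1]
  -- First pass: the crude norm bound on `F` alone.
  have h3 : vnorm (v - x) ≤ 1 / 2 := by
    have h4 := hF v
    rw [← h2, hv] at h4
    have : τ * vnorm (v - x) ≤ |ρ| * vnorm (v - x) :=
      mul_le_mul_of_nonneg_right hρ (vnorm_nonneg _)
    have h5 : τ * vnorm (v - x) ≤ τ * (1 / 2) := by linarith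
    exact le_of_mul_le_mul_left h5 hτ
  have h6 : vnorm x ≤ 3 / 2 := by
    have : x = v - (v - x) := by abel
    rw [this]
    refine (vnorm_sub_le _ _).trans ?_
    rw [hv]; linarith
  -- Second pass: `F` is bounded by `η` on the block part, whose norm is at most `3 / 2`, and by `τ
  -- / 2` on the rest. The latter term is absorbed into the left side.
  have h7 : vnorm (F *ᵥ v) ≤ η * (3 / 2) + τ / 2 * vnorm (v - x) := by
    have e : F *ᵥ v = F *ᵥ x + F *ᵥ (v - x) := by rw [← mulVec_add]; congr 1; abel
    rw [e]
    refine (vnorm_add_le _ _).trans (add_le_add ((hFb _).trans ?_) (hF _))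
    exact mul_le_mul_of_nonneg_left h6 hη
  have h8 : τ * vnorm (v - x) ≤ η * (3 / 2) + τ / 2 * vnorm (v - x) := by
    refine le_trans ?_ (h2.le.trans h7)
    exact mul_le_mul_of_nonneg_right hρ (vnorm_nonneg _)
  rw [le_div_iff₀ hτ]
  linarith

/-! ### From approximate block rows to labels -/

/-- The label vector of the communities. -/
def blockLabel : Fin n → ℝ := fun i => if c i = 0 then 1 else -1

theorem sqDist_le_four_mul {e l : Fin n → ℝ} (he : ∀ i, e i = 1 ∨ e i = -1)
    (hl : ∀ i, l i = 1 ∨ l i = -1) : sqDist e l ≤ 4 * n := by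
  refine (min_le_left _ _).trans ?_
  rw [norm_toLp_sq, dotProduct]
  calc _ ≤ ∑ _i : Fin n, (4 : ℝ) := by
        refine Finset.sum_le_sum fun i _ => ?_
        rcases he i with h | h <;> rcases hl i with h' | h' <;> simp [h, h'] <;> norm_num
    _ = _ := by simp; ring

/-- Labels in `{1, -1}` that disagree differ by 2, so each error counts 4 in the squared distance.
-/
theorem misFraction_eq {e l : Fin n → ℝ} (he : ∀ i, e i = 1 ∨ e i = -1)
    (hl : ∀ i, l i = 1 ∨ l i = -1) : misFraction e l = 1 / 4 * (1 / (n : ℝ) * sqDist e l) := by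
  have key : ∀ l : Fin n → ℝ, (∀ i, l i = 1 ∨ l i = -1) →
      ‖WithLp.toLp 2 (e - l)‖ ^ 2 = 4 * (({i | e i ≠ l i} : Set (Fin n)).ncard : ℝ) := by
    intro l hl
    have hs : ({i | e i ≠ l i} : Set (Fin n)) =
        ((Finset.univ.filter fun i => e i ≠ l i : Finset (Fin n)) : Set (Fin n)) := by
      ext i; simp
    rw [hs, Set.ncard_coe_finset, norm_toLp_sq, dotProduct, Finset.card_filter]
    push_cast
    rw [Finset.mul_sum]
    refine Finset.sum_congr rfl fun i _ => ?_
    rcases he i with h | h <;> rcases hl i with h' | h' <;> simp [h, h'] <;> norm_num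
  have h2 : ‖WithLp.toLp 2 (e + l)‖ ^ 2 = 4 * (({i | e i ≠ -l i} : Set (Fin n)).ncard : ℝ) := by
    have := key (-l) fun i => by rcases hl i with h | h <;> simp [h]
    rwa [sub_neg_eq_add] at this
  unfold misFraction sqDist
  rw [key l hl, h2, ← mul_min_of_nonneg _ _ (by norm_num : (0 : ℝ) ≤ 4)]
  push_cast
  ring

theorem vnorm_one_sq : vnorm (1 : Fin n → ℝ) ^ 2 = n := by
  rw [vnorm_sq]; simp

theorem vnorm_score_sub_le {U V : Matrix (Fin 2) (Fin n) ℝ} {η : ℝ} (hη1 : η ≤ 1)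
    (hV : ∀ k, vnorm (V k) ≤ 3 / 2) (hUV : ∀ k, vnorm (U k - V k) ≤ η) :
    vnorm (score U - score V) ≤ 8 * η * vnorm (1 : Fin n → ℝ) := by
  have hη : 0 ≤ η := (vnorm_nonneg _).trans (hUV 0)
  set s := vnorm (1 : Fin n → ℝ)
  have hs : 0 ≤ s := vnorm_nonneg _
  have h1 : ∀ k, |(U k - V k) ⬝ᵥ 1| ≤ η * s := fun k =>
    (abs_dotProduct_le _ _).trans (mul_le_mul_of_nonneg_right (hUV k) hs)
  have h2 : ∀ k, |V k ⬝ᵥ 1| ≤ 3 / 2 * s := fun k =>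
    (abs_dotProduct_le _ _).trans (mul_le_mul_of_nonneg_right (hV k) hs)
  have h3 : ∀ k, vnorm (U k) ≤ 5 / 2 := fun k => by
    have : U k = (U k - V k) + V k := by abel
    rw [this]
    exact (vnorm_add_le _ _).trans (by linarith [hV k, hUV k])
  have h4 : ∀ k l, vnorm ((U k ⬝ᵥ 1) • U l - (V k ⬝ᵥ 1) • V l) ≤ 4 * η * s := fun k l => by
    have e : (U k ⬝ᵥ 1) • U l - (V k ⬝ᵥ 1) • V l =
        ((U k - V k) ⬝ᵥ 1) • U l + (V k ⬝ᵥ 1) • (U l - V l) := by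
      rw [sub_dotProduct, sub_smul, smul_sub]; abel
    rw [e]
    refine (vnorm_add_le _ _).trans ?_
    rw [vnorm_smul, vnorm_smul]
    have a1 := mul_le_mul (h1 k) (h3 l) (vnorm_nonneg _) (by positivity)
    have a2 := mul_le_mul (h2 k) (hUV l) (vnorm_nonneg _) (by positivity)
    linarith
  have e : score U - score V = ((U 0 ⬝ᵥ 1) • U 1 - (V 0 ⬝ᵥ 1) • V 1) -
      ((U 1 ⬝ᵥ 1) • U 0 - (V 1 ⬝ᵥ 1) • V 0) := by
    unfold score; abel
  rw [e]
  refine (vnorm_sub_le _ _).trans ?_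
  linarith [h4 0 1, h4 1 0]

/-- The estimate computed from rows close to block vectors that are nearly orthonormal. -/
theorem sqDist_le_of_close {κ η : ℝ} (hκ : 0 < κ) (hn : 0 < n)
    (hc : ∀ a, κ * n ≤ blockSize c a) {U V : Matrix (Fin 2) (Fin n) ℝ} {e : Fin n → ℝ}
    (he : IsEstimate U e) (f : Fin 2 → Fin 2 → ℝ) (hVf : ∀ k, V k = blockVec c (f k))
    (hη1 : η ≤ 1) (hV : ∀ k, vnorm (V k) ≤ 3 / 2) (hUV : ∀ k, vnorm (U k - V k) ≤ η)
    (hG : 1 / 4 ≤ (V 0 ⬝ᵥ V 0) * (V 1 ⬝ᵥ V 1) - (V 0 ⬝ᵥ V 1) ^ 2) :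
    1 / (n : ℝ) * sqDist e (blockLabel c) ≤ 256 / κ ^ 2 * η ^ 2 := by
  have hn' : (0 : ℝ) < n := by exact_mod_cast hn
  set m₀ := blockSize c 0
  set m₁ := blockSize c 1
  have hm : m₀ + m₁ = n := blockSize_add c
  have h0 : κ * n ≤ m₀ := hc 0
  have h1 : κ * n ≤ m₁ := hc 1
  have hκn : 0 < κ * n := by positivity
  -- The determinant of the block values. The Gram determinant of the rows is `m₀ * m₁ * Δ ^ 2`, so
  -- independence of the rows bounds `|Δ|` from below by `1 / n`.
  set Δ := f 0 0 * f 1 1 - f 0 1 * f 1 0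
  have hGΔ : (V 0 ⬝ᵥ V 0) * (V 1 ⬝ᵥ V 1) - (V 0 ⬝ᵥ V 1) ^ 2 = m₀ * m₁ * Δ ^ 2 := by
    rw [hVf, hVf, blockVec_dotProduct, blockVec_dotProduct, blockVec_dotProduct]
    simp only [Δ]; ring
  have hΔ : 1 ≤ (n * Δ) ^ 2 := by
    rw [hGΔ] at hG
    have : m₀ * m₁ ≤ n ^ 2 / 4 := by rw [← hm]; nlinarith [sq_nonneg (m₀ - m₁)]
    nlinarith [mul_le_mul_of_nonneg_right this (sq_nonneg Δ)]
  -- The score lies in the block plane and is orthogonal to the all-ones vector, hence takes two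
  -- values of opposite sign, both of absolute value at least `κ`.
  have hs : ∀ i, score V i = if c i = 0 then -(m₁ * Δ) else m₀ * Δ := fun i => by
    unfold score
    rw [hVf, hVf, blockVec_dotProduct_one, blockVec_dotProduct_one]
    simp only [Pi.sub_apply, Pi.smul_apply, blockVec, smul_eq_mul, Δ]
    by_cases h : c i = 0
    · rw [if_pos h, h]; ring
    · rw [if_neg h, Fin.eq_one_of_ne_zero _ h]; ring
  have hΔabs : 1 ≤ n * |Δ| := by
    have : 1 ≤ |n * Δ| := (one_le_sq_iff_one_le_abs _).1 hΔ
    rwa [abs_mul, abs_of_pos hn'] at this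
  have hκΔ : ∀ m, κ * n ≤ m → κ ≤ m * |Δ| := fun m hm => by
    calc κ = κ * 1 := (mul_one κ).symm
      _ ≤ κ * (n * |Δ|) := by gcongr
      _ = κ * n * |Δ| := by ring
      _ ≤ _ := by gcongr
  have hκ0 := hκΔ m₀ h0
  have hκ1 := hκΔ m₁ h1
  -- A wrong label forces the two scores to differ by at least `κ` at that node. The constant is
  -- `256 = 4 * 8 ^ 2`, with 8 from the perturbation of the score; `s` is the global sign, fixed by
  -- the sign of `Δ`.
  have main : ∀ s : ℝ, (∀ i, (e i - s * blockLabel c i) ^ 2 ≤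
      4 / κ ^ 2 * (score U i - score V i) ^ 2) →
      ‖WithLp.toLp 2 (e - s • blockLabel c)‖ ^ 2 ≤ n * (256 / κ ^ 2 * η ^ 2) := by
    intro s hi
    have h2 := vnorm_score_sub_le hη1 hV hUV
    have h3 : vnorm (score U - score V) ^ 2 ≤ (8 * η * vnorm (1 : Fin n → ℝ)) ^ 2 :=
      pow_le_pow_left₀ (vnorm_nonneg _) h2 2
    rw [mul_pow, vnorm_one_sq, vnorm_sq] at h3
    rw [norm_toLp_sq]
    calc _ ≤ ∑ i, 4 / κ ^ 2 * (score U i - score V i) ^ 2 := by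
          refine Finset.sum_le_sum fun i _ => ?_
          rw [← pow_two]
          exact hi i
      _ = 4 / κ ^ 2 * ((score U - score V) ⬝ᵥ (score U - score V)) := by
          rw [← Finset.mul_sum, dotProduct]
          simp only [Pi.sub_apply, pow_two]
      _ ≤ 4 / κ ^ 2 * ((8 * η) ^ 2 * n) := by gcongr
      _ = _ := by ring
  have hlarge : ∀ x : ℝ, κ ≤ |x| → 4 ≤ 4 / κ ^ 2 * x ^ 2 := fun x hx => by
    rw [div_mul_eq_mul_div, le_div_iff₀ (by positivity), ← sq_abs x]
    gcongr
  have hpos : ∀ x : ℝ, 0 ≤ 4 / κ ^ 2 * x ^ 2 := fun x => by positivity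
  rw [one_div, inv_mul_le_iff₀ hn']
  rcases lt_or_ge Δ 0 with hΔ0 | hΔ0
  · refine (min_le_left _ _).trans ?_
    have := main 1 fun i => ?_
    · simpa using this
    obtain ⟨h2, h3, h4⟩ := he i
    rw [abs_of_neg hΔ0] at hκ0 hκ1
    rw [hs i]
    unfold blockLabel
    split_ifs with hci
    · rcases h2 with h2 | h2
      · rw [h2]; simpa using hpos _
      · have : score U i ≤ 0 := by
          by_contra! h5
          rw [h3 h5] at h2
          norm_num at h2
        rw [h2]
        refine le_trans (by norm_num) (hlarge _ ?_)
        rw [le_abs]; right; linarith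
    · rcases h2 with h2 | h2
      · have : 0 ≤ score U i := by
          by_contra! h5
          rw [h4 h5] at h2
          norm_num at h2
        rw [h2]
        refine le_trans (by norm_num) (hlarge _ ?_)
        rw [le_abs]; left; linarith
      · rw [h2]; simpa using hpos _
  · refine (min_le_right _ _).trans ?_
    have := main (-1) fun i => ?_
    · simpa using this
    obtain ⟨h2, h3, h4⟩ := he i
    rw [abs_of_nonneg hΔ0] at hκ0 hκ1
    rw [hs i]
    unfold blockLabel
    split_ifs with hci
    · rcases h2 with h2 | h2
      · have : 0 ≤ score U i := by
          by_contra! h5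
          rw [h4 h5] at h2
          norm_num at h2
        rw [h2]
        refine le_trans (by norm_num) (hlarge _ ?_)
        rw [le_abs]; left; linarith
      · rw [h2]; simpa using hpos _
    · rcases h2 with h2 | h2
      · rw [h2]; simpa using hpos _
      · have : score U i ≤ 0 := by
          by_contra! h5
          rw [h3 h5] at h2
          norm_num at h2
        rw [h2]
        refine le_trans (by norm_num) (hlarge _ ?_)
        rw [le_abs]; right; linarith

theorem blockLabel_eq (i : Fin n) : blockLabel c i = 1 ∨ blockLabel c i = -1 := by
  unfold blockLabel
  split_ifs <;> simp

theorem dotProduct_of_orthonormal {U : Matrix (Fin 2) (Fin n) ℝ} (hU : U * Uᵀ = 1) (k l : Fin 2) :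
    U k ⬝ᵥ U l = if k = l then 1 else 0 := by
  have := congr_fun₂ hU k l
  rw [Matrix.mul_apply, Matrix.one_apply] at this
  exact this

theorem inv_mul_sqDist_le_four (hn : 0 < n) {U : Matrix (Fin 2) (Fin n) ℝ} {e : Fin n → ℝ}
    (he : IsEstimate U e) : 1 / (n : ℝ) * sqDist e (blockLabel c) ≤ 4 := by
  have hn' : (0 : ℝ) < n := by exact_mod_cast hn
  have := sqDist_le_four_mul (fun i => (he i).1) (blockLabel_eq c)
  rw [one_div, inv_mul_le_iff₀ hn']
  linarith

/-- The estimate computed from orthonormal rows close to block vectors. -/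
theorem sqDist_le_of_orthonormal {κ η : ℝ} (hκ : 0 < κ) (hn : 0 < n)
    (hc : ∀ a, κ * n ≤ blockSize c a) {U : Matrix (Fin 2) (Fin n) ℝ} {e : Fin n → ℝ}
    (he : IsEstimate U e) (hU : U * Uᵀ = 1) (f : Fin 2 → Fin 2 → ℝ)
    (hUf : ∀ k, vnorm (U k - blockVec c (f k)) ≤ η) :
    1 / (n : ℝ) * sqDist e (blockLabel c) ≤ (256 / κ ^ 2 + 1600) * η ^ 2 := by
  have hη : 0 ≤ η := (vnorm_nonneg _).trans (hUf 0)
  have hκ2 : 0 ≤ 256 / κ ^ 2 := by positivity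
  -- For `η ≤ 1 / 20` the block approximants are still nearly orthonormal, with Gram determinant
  -- above `1 / 4`. Otherwise the trivial bound `4 = 1600 * (1 / 20) ^ 2` suffices, whence the
  -- constant 1600.
  rcases le_or_gt η (1 / 20) with h | h
  · set V : Matrix (Fin 2) (Fin n) ℝ := Matrix.of fun k => blockVec c (f k)
    have hV : ∀ k, vnorm (U k - V k) ≤ η := hUf
    have hUn : ∀ k, vnorm (U k) = 1 := fun k =>
      vnorm_eq_one (by rw [dotProduct_of_orthonormal hU, if_pos rfl])
    have hVn : ∀ k, vnorm (V k) ≤ 1 + η := fun k => by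
      have : V k = U k - (U k - V k) := by abel
      rw [this]
      exact (vnorm_sub_le _ _).trans (by rw [hUn]; linarith [hV k])
    have hd : ∀ k l, |V k ⬝ᵥ V l - U k ⬝ᵥ U l| ≤ 1 / 8 := fun k l => by
      have e : V k ⬝ᵥ V l - U k ⬝ᵥ U l = -(V k ⬝ᵥ (U l - V l)) - (U k - V k) ⬝ᵥ U l := by
        rw [dotProduct_sub, sub_dotProduct]; ring
      rw [e]
      refine (abs_sub _ _).trans ?_
      rw [abs_neg]
      have a1 := (abs_dotProduct_le (V k) (U l - V l)).trans
        (mul_le_mul (hVn k) (hV l) (vnorm_nonneg _) (by linarith))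
      have a2 := (abs_dotProduct_le (U k - V k) (U l)).trans
        (mul_le_mul_of_nonneg_right (hV k) (vnorm_nonneg _))
      rw [hUn] at a2
      nlinarith
    have b0 := abs_le.1 (hd 0 0)
    have b1 := abs_le.1 (hd 1 1)
    have b2 := hd 0 1
    rw [dotProduct_of_orthonormal hU] at b0 b1 b2
    simp only [if_true, zero_ne_one, if_false, sub_zero, Fin.isValue] at b0 b1 b2
    have b3 : (V 0 ⬝ᵥ V 1) ^ 2 ≤ (1 / 8) ^ 2 := by
      rw [← sq_abs]; gcongr
    refine (sqDist_le_of_close c hκ hn hc he f (V := V) (fun k => rfl) (by linarith)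
      (fun k => (hVn k).trans (by linarith)) hV ?_).trans ?_
    · nlinarith
    · nlinarith [sq_nonneg η]
  · refine (inv_mul_sqDist_le_four c hn he).trans ?_
    nlinarith [sq_nonneg η]

theorem vnorm_mulVec_le {m : ℕ} (M : Matrix (Fin m) (Fin n) ℝ) (x : Fin n → ℝ) :
    vnorm (M *ᵥ x) ≤ ‖M‖ * vnorm x :=
  M.l2_opNorm_mulVec (WithLp.toLp 2 x)

theorem vnorm_row_le {m : ℕ} (M : Matrix (Fin m) (Fin n) ℝ) (k : Fin m) :
    vnorm (M k) ≤ ‖M‖ := by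
  have h := vnorm_mulVec_le Mᵀ (Pi.single k 1)
  have h1 : ‖Mᵀ‖ = ‖M‖ := by
    rw [← conjTranspose_eq_transpose_of_trivial, l2_opNorm_conjTranspose]
  have h2 : Mᵀ *ᵥ Pi.single k 1 = M k := by
    ext j
    simp
  have h3 : vnorm (Pi.single k 1 : Fin m → ℝ) = 1 := vnorm_eq_one (by simp)
  rwa [h1, h2, h3, mul_one] at h

/-- The estimate in terms of the distance to orthonormal block rows. -/
theorem sqDist_le_norm_sub {κ : ℝ} (hκ : 0 < κ) (hn : 0 < n)
    (hc : ∀ a, κ * n ≤ blockSize c a) {U Ubar : Matrix (Fin 2) (Fin n) ℝ} {e : Fin n → ℝ}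
    (he : IsEstimate U e) (hU : Ubar * Ubarᵀ = 1) (f : Fin 2 → Fin 2 → ℝ)
    (hUf : ∀ k, Ubar k = blockVec c (f k)) :
    1 / (n : ℝ) * sqDist e (blockLabel c) ≤ (256 / κ ^ 2 + 1600) * ‖U - Ubar‖ ^ 2 := by
  have hκ2 : 0 ≤ 256 / κ ^ 2 := by positivity
  rcases le_or_gt ‖U - Ubar‖ 1 with h | h
  · refine (sqDist_le_of_close c hκ hn hc he f hUf h (fun k => ?_) (vnorm_row_le (U - Ubar)) ?_).trans ?_
    · rw [vnorm_eq_one (by rw [dotProduct_of_orthonormal hU, if_pos rfl])]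
      norm_num
    · simp only [dotProduct_of_orthonormal hU]
      norm_num
    · gcongr
      linarith
  · refine (inv_mul_sqDist_le_four c hn he).trans ?_
    nlinarith

/-- The estimate in terms of the distance between the row spaces. -/
theorem sqDist_le_norm_proj_sub {κ : ℝ} (hκ : 0 < κ) (hn : 0 < n)
    (hc : ∀ a, κ * n ≤ blockSize c a) {U Ubar : Matrix (Fin 2) (Fin n) ℝ} {e : Fin n → ℝ}
    (he : IsEstimate U e) (hU : U * Uᵀ = 1) (f : Fin 2 → Fin 2 → ℝ)
    (hUf : ∀ k, Ubar k = blockVec c (f k)) :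
    1 / (n : ℝ) * sqDist e (blockLabel c) ≤
      (256 / κ ^ 2 + 1600) * ‖Uᵀ * U - Ubarᵀ * Ubar‖ ^ 2 := by
  -- The block vector compared with `U k` is its image under `Ubarᵀ * Ubar`. Since `Uᵀ * U` fixes `U
  -- k`, the distance is at most the norm of the difference of the two matrices.
  refine sqDist_le_of_orthonormal c hκ hn hc he hU
    (fun k => (Ubar *ᵥ U k) 0 • f 0 + (Ubar *ᵥ U k) 1 • f 1) fun k => ?_
  have h1 : (Uᵀ * U) *ᵥ U k = U k := by
    have : U *ᵥ U k = Pi.single k 1 := by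
      ext j
      rw [mulVec, dotProduct_of_orthonormal hU, Pi.single_apply]
    rw [← mulVec_mulVec, this]
    ext j
    simp
  have h2 : (Ubarᵀ * Ubar) *ᵥ U k =
      blockVec c ((Ubar *ᵥ U k) 0 • f 0 + (Ubar *ᵥ U k) 1 • f 1) := by
    rw [← mulVec_mulVec]
    ext i
    rw [mulVec, dotProduct, Fin.sum_univ_two]
    simp only [transpose_apply, hUf, blockVec, Pi.add_apply, Pi.smul_apply, smul_eq_mul]
    ring
  have h3 := vnorm_mulVec_le (Uᵀ * U - Ubarᵀ * Ubar) (U k)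
  rw [sub_mulVec, h1, h2, vnorm_eq_one (x := U k)
    (by rw [dotProduct_of_orthonormal hU, if_pos rfl]), mul_one] at h3
  exact h3

end Blocks

/-! ### Application to the two-community model -/

theorem blockSize_community_zero {π₁ : ℝ} (h₁ : π₁ ≤ 1) (n : ℕ) :
    blockSize (community π₁ n) 0 = (⌊π₁ * n⌋₊ : ℝ) := by
  have hle : ⌊π₁ * n⌋₊ ≤ n := by
    rw [← Nat.floor_natCast (R := ℝ) n]
    exact Nat.floor_le_floor (by simpa using mul_le_mul_of_nonneg_right h₁ (Nat.cast_nonneg (α := ℝ) n))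
  have e : (Finset.univ.filter fun i => community π₁ n i = 0) =
      Finset.univ.filter fun i : Fin n => (i : ℕ) < ⌊π₁ * n⌋₊ := by
    ext i
    simp only [Finset.mem_filter, Finset.mem_univ, true_and, community]
    by_cases h : (i : ℕ) < ⌊π₁ * n⌋₊ <;> simp [h]
  rw [blockSize, e, Fin.card_filter_val_lt, min_eq_right hle]

theorem eventually_le_blockSize_community {π₁ : ℝ} (h₀ : 0 < π₁) (h₁ : π₁ < 1) :
    ∀ᶠ n : ℕ in atTop, ∀ a, min π₁ (1 - π₁) / 2 * n ≤ blockSize (community π₁ n) a := by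
  filter_upwards [eventually_ge_atTop ⌈2 / π₁⌉₊] with n hn a
  have hn' : 2 ≤ π₁ * n := by
    have := Nat.ceil_le.1 hn
    rw [div_le_iff₀ h₀] at this
    linarith
  have h0 := blockSize_community_zero h₁.le n
  have hs := blockSize_add (community π₁ n)
  have hf1 : (⌊π₁ * n⌋₊ : ℝ) ≤ π₁ * n := Nat.floor_le (by positivity)
  have hf2 := Nat.lt_floor_add_one (π₁ * n)
  have hn0 : (0 : ℝ) ≤ n := Nat.cast_nonneg n
  have hm1 := mul_le_mul_of_nonneg_right (min_le_left π₁ (1 - π₁)) hn0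
  have hm2 := mul_le_mul_of_nonneg_right (min_le_right π₁ (1 - π₁)) hn0
  have hm0 : 0 ≤ (1 - π₁) * n := mul_nonneg (by linarith) hn0
  rcases Fin.exists_fin_two.1 ⟨a, rfl⟩ with rfl | rfl
  · rw [h0]; linarith
  · linarith

namespace IsSBM

variable {Ω : Type*} [MeasurableSpace Ω] {μ : Measure Ω} [IsProbabilityMeasure μ]
  {π₁ r w lam : ℝ} {n : ℕ} {A : Ω → Matrix (Fin n) (Fin n) ℝ}

/-- The model itself forces these numbers to be probabilities, but only if each one is attained by a
pair of distinct nodes; inside a community this takes two members. -/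
theorem blockProb_mem (h : IsSBM μ π₁ r w lam n A)
    (hs : ∀ a, 2 ≤ blockSize (community π₁ n) a) (a b : Fin 2) :
    0 ≤ blockProb r w lam n a b ∧ blockProb r w lam n a b ≤ 1 := by
  have hs' : ∀ a, 1 < (Finset.univ.filter fun i => community π₁ n i = a).card := fun a => by
    have := hs a
    unfold blockSize at this
    exact_mod_cast this
  obtain ⟨i, hi, i', hi', hii⟩ := Finset.one_lt_card.1 (hs' a)
  obtain ⟨j, hj⟩ := Finset.card_pos.1 (zero_lt_one.trans (hs' b))
  have hi := (Finset.mem_filter.1 hi).2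
  have hi' := (Finset.mem_filter.1 hi').2
  have hj := (Finset.mem_filter.1 hj).2
  obtain ⟨k, hk, hkj⟩ : ∃ k, community π₁ n k = a ∧ k ≠ j := by
    by_cases hij : i = j
    · exact ⟨i', hi', fun h => hii (hij.trans h.symm)⟩
    · exact ⟨i, hi, hij⟩
  have := h.expMatrix_apply_mem k j
  rwa [h.expMatrix_of_ne hkj, hk, hj] at this

theorem lam_nonneg (h : IsSBM μ π₁ r w lam n A) (hn : 0 < n)
    (hs : ∀ a, 2 ≤ blockSize (community π₁ n) a) : 0 ≤ lam := by
  have hn' : (0 : ℝ) < n := by exact_mod_cast hn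
  have := (h.blockProb_mem hs 0 0).1
  simp only [blockProb, Matrix.smul_apply, Matrix.of_apply, Matrix.cons_val', Matrix.cons_val_zero,
    Matrix.cons_val_fin_one, smul_eq_mul, mul_one] at this
  have h2 := mul_nonneg this hn'.le
  rwa [div_mul_cancel₀ _ hn'.ne'] at h2

theorem maxProb_le_one (h : IsSBM μ π₁ r w lam n A)
    (hs : ∀ a, 2 ≤ blockSize (community π₁ n) a) : lam * max 1 (max r w) / n ≤ 1 := by
  have h00 := (h.blockProb_mem hs 0 0).2
  have h01 := (h.blockProb_mem hs 0 1).2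
  have h11 := (h.blockProb_mem hs 1 1).2
  simp [blockProb] at h00 h01 h11
  rw [mul_div_right_comm]
  rcases max_choice 1 (max r w) with h | h
  · rw [h]; simpa
  rcases max_choice r w with h' | h' <;> rw [h, h'] <;> assumption

theorem blockProb_le_maxProb (hn : 0 < n) (hlam : 0 ≤ lam) (a b : Fin 2) :
    blockProb r w lam n a b ≤ lam * max 1 (max r w) / n := by
  have hq : 0 ≤ lam / n := by positivity
  have h1 : (1 : ℝ) ≤ max 1 (max r w) := le_max_left _ _
  have h2 : r ≤ max 1 (max r w) := (le_max_left _ _).trans (le_max_right _ _)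
  have h3 : w ≤ max 1 (max r w) := (le_max_right _ _).trans (le_max_right _ _)
  rw [mul_div_right_comm]
  fin_cases a <;> fin_cases b <;> simp only [blockProb, Matrix.smul_apply, smul_eq_mul] <;>
    refine mul_le_mul_of_nonneg_left ?_ hq <;> simpa

theorem expMatrix_le_maxProb (h : IsSBM μ π₁ r w lam n A) (hn : 0 < n) (hlam : 0 ≤ lam)
    (i j : Fin n) : expMatrix μ A i j ≤ lam * max 1 (max r w) / n := by
  by_cases hij : i = j
  · rw [hij, h.expMatrix_diag]
    positivity
  · rw [h.expMatrix_of_ne hij]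
    exact blockProb_le_maxProb hn hlam _ _

theorem expMatrix_sub_signal_mulVec (h : IsSBM μ π₁ r w lam n A) (x : Fin n → ℝ) (i : Fin n) :
    ((expMatrix μ A - signal (community π₁ n) r w lam) *ᵥ x) i =
      -(blockProb r w lam n (community π₁ n i) (community π₁ n i)) * x i := by
  rw [mulVec, dotProduct, Finset.sum_eq_single i]
  · simp [h.expMatrix_diag, signal]
  · intro j _ hj
    simp [h.expMatrix_of_ne hj.symm, signal]
  · simp

theorem vnorm_expMatrix_sub_signal_le (h : IsSBM μ π₁ r w lam n A)
    (hs : ∀ a, 2 ≤ blockSize (community π₁ n) a) (x : Fin n → ℝ) :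
    vnorm ((expMatrix μ A - signal (community π₁ n) r w lam) *ᵥ x) ≤ vnorm x := by
  rw [← one_mul (vnorm x)]
  refine vnorm_le_of_dotProduct_le zero_le_one ?_
  rw [one_pow, one_mul]
  refine Finset.sum_le_sum fun i _ => ?_
  rw [h.expMatrix_sub_signal_mulVec]
  obtain ⟨h0, h1⟩ := h.blockProb_mem hs (community π₁ n i) (community π₁ n i)
  nlinarith [mul_self_nonneg (x i), mul_le_one₀ h1 h0 h1]

/-- The leading eigenvectors of the expected adjacency matrix are constant on communities. -/
theorem exists_blockVec_of_isLeadingPair (h : IsSBM μ π₁ r w lam n A) (hn : 0 < n)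
    (hs : ∀ a, 2 ≤ blockSize (community π₁ n) a) {κ : ℝ} (hκ : 0 < κ)
    (hc : ∀ a, κ * n ≤ blockSize (community π₁ n) a) (hlam : 2 < signalConst κ r w * lam)
    {U : Matrix (Fin 2) (Fin n) ℝ} (hU : IsLeadingPair (expMatrix μ A) U) :
    ∃ f : Fin 2 → Fin 2 → ℝ, ∀ k, U k = blockVec (community π₁ n) (f k) := by
  obtain ⟨ρ, hρ, hlead⟩ := hU.leading
  have hdec : expMatrix μ A = signal (community π₁ n) r w lam +
      (expMatrix μ A - signal (community π₁ n) r w lam) := by abel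
  have hbig : ∀ k, signalConst κ r w * lam - 1 ≤ |ρ k| := by
    refine le_abs_eigenvalue h.expMatrix_isSymm hU.orthonormal hρ hlead fun u => ?_
    obtain ⟨f, hf0, hf⟩ := exists_blockVec_orthogonal (community π₁ n)
      (fun a => zero_lt_two.trans_le (hs a)) u
    refine ⟨_, hf0, hf, ?_⟩
    have h1 := le_vnorm_signal_mulVec (community π₁ n) (r := r) (w := w)
      (lam := lam) hκ hn hc f
    have h2 := h.vnorm_expMatrix_sub_signal_le hs (blockVec (community π₁ n) f)
    have h3 : signal (community π₁ n) r w lam *ᵥ blockVec (community π₁ n) f =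
        expMatrix μ A *ᵥ blockVec (community π₁ n) f -
        (expMatrix μ A - signal (community π₁ n) r w lam) *ᵥ blockVec (community π₁ n) f := by
      rw [← sub_mulVec]; congr 1; abel
    rw [h3] at h1
    have h4 := h1.trans (vnorm_sub_le _ _)
    linarith
  have : ∀ k, ∃ f, U k = blockVec (community π₁ n) f := fun k => by
    obtain ⟨g, hg⟩ := signal_mulVec (community π₁ n) r w lam (U k)
    -- The expectation is the signal minus a diagonal that is constant on communities, so the
    -- eigenvalue equation can be solved entrywise. The denominator cannot vanish: `ρ k` has
    -- absolute value above 1, while the diagonal entries are at most 1.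
    refine ⟨fun a => g a / (ρ k + blockProb r w lam n a a), ?_⟩
    ext i
    have h1 := congrFun (hρ k) i
    rw [hdec, add_mulVec, hg, Pi.add_apply, h.expMatrix_sub_signal_mulVec] at h1
    have h2 := (h.blockProb_mem hs (community π₁ n i) (community π₁ n i))
    simp only [blockVec, Pi.smul_apply, smul_eq_mul] at h1 ⊢
    rw [eq_div_iff]
    · linarith
    · intro h0
      have h3 : ρ k = -blockProb r w lam n (community π₁ n i) (community π₁ n i) := by linarith
      have h4 := hbig k
      rw [h3, abs_neg, abs_of_nonneg h2.1] at h4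
      linarith
  choose f hf using this
  exact ⟨f, hf⟩

/-- The noise is small on block vectors. -/
theorem vnorm_noise_mulVec_blockVec_le {c : Fin n → Fin 2} {κ L : ℝ} (hκ : 0 < κ) (hn : 0 < n)
    (hL : 0 ≤ L) (hc : ∀ a, κ * n ≤ blockSize c a) {E : Matrix (Fin n) (Fin n) ℝ}
    (hE : ∀ a, (E *ᵥ blockVec c (Pi.single a 1)) ⬝ᵥ (E *ᵥ blockVec c (Pi.single a 1)) ≤ 4 * n * L)
    (f : Fin 2 → ℝ) : vnorm (E *ᵥ blockVec c f) ≤ √(8 * L / κ) * vnorm (blockVec c f) := by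
  have hn' : (0 : ℝ) < n := by exact_mod_cast hn
  have hs : ∀ a, vnorm (E *ᵥ blockVec c (Pi.single a 1)) ≤ √(4 * n * L) := fun a => by
    refine Real.le_sqrt_of_sq_le ?_
    rw [vnorm_sq]
    exact hE a
  have e : E *ᵥ blockVec c f = f 0 • (E *ᵥ blockVec c (Pi.single 0 1)) +
      f 1 • (E *ᵥ blockVec c (Pi.single 1 1)) := by
    rw [← mulVec_smul, ← mulVec_smul, ← mulVec_add]
    congr 1
    ext i
    simp only [blockVec, Pi.add_apply, Pi.smul_apply, smul_eq_mul, Pi.single_apply]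
    rcases Fin.exists_fin_two.1 ⟨c i, rfl⟩ with h | h <;> simp [h]
  have h1 : vnorm (E *ᵥ blockVec c f) ≤ √(4 * n * L) * (|f 0| + |f 1|) := by
    rw [e]
    refine (vnorm_add_le _ _).trans ?_
    rw [vnorm_smul, vnorm_smul]
    have a0 := mul_le_mul_of_nonneg_left (hs 0) (abs_nonneg (f 0))
    have a1 := mul_le_mul_of_nonneg_left (hs 1) (abs_nonneg (f 1))
    linarith
  refine h1.trans ?_
  refine le_of_sq_le_sq ?_ (mul_nonneg (Real.sqrt_nonneg _) (vnorm_nonneg _))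
  rw [mul_pow, mul_pow, Real.sq_sqrt (by positivity), Real.sq_sqrt (by positivity), vnorm_sq,
    blockVec_dotProduct]
  have b0 := mul_le_mul_of_nonneg_right (hc 0) (mul_self_nonneg (f 0))
  have b1 := mul_le_mul_of_nonneg_right (hc 1) (mul_self_nonneg (f 1))
  have b2 : (|f 0| + |f 1|) ^ 2 ≤ 2 * (f 0 * f 0 + f 1 * f 1) := by
    have := sq_nonneg (|f 0| - |f 1|)
    have := sq_abs (f 0)
    have := sq_abs (f 1)
    nlinarith
  calc 4 * n * L * (|f 0| + |f 1|) ^ 2 ≤ 4 * n * L * (2 * (f 0 * f 0 + f 1 * f 1)) := by gcongr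
    _ = 8 * L / κ * (κ * n * (f 0 * f 0) + κ * n * (f 1 * f 1)) := by field_simp; ring
    _ ≤ _ := by gcongr

/-- The leading eigenvectors of the adjacency matrix are close to block vectors if the noise is
small. -/
theorem exists_blockVec_close_of_isLeadingPair (h : IsSBM μ π₁ r w lam n A) (hn : 0 < n)
    (hs : ∀ a, 2 ≤ blockSize (community π₁ n) a) {κ L σ : ℝ} (hκ : 0 < κ) (hL : 0 ≤ L)
    (hσ : 0 ≤ σ) (hc : ∀ a, κ * n ≤ blockSize (community π₁ n) a) {x : Ω}
    (hE : ∀ z, (noise μ A x *ᵥ z) ⬝ᵥ (noise μ A x *ᵥ z) ≤ σ ^ 2 * (z ⬝ᵥ z))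
    (hEb : ∀ a, (noise μ A x *ᵥ blockVec (community π₁ n) (Pi.single a 1)) ⬝ᵥ
      (noise μ A x *ᵥ blockVec (community π₁ n) (Pi.single a 1)) ≤ 4 * n * L) {τ : ℝ} (hτ : 0 < τ)
    (hτ1 : τ + (√(8 * L / κ) + 1) ≤ signalConst κ r w * lam) (hτ2 : σ + 1 ≤ τ / 2)
    {U : Matrix (Fin 2) (Fin n) ℝ} (hU : IsLeadingPair (A x) U) :
    ∃ f : Fin 2 → Fin 2 → ℝ, ∀ k, vnorm (U k - blockVec (community π₁ n) (f k)) ≤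
      3 * (√(8 * L / κ) + 1) / τ := by
  obtain ⟨ρ, hρ, hlead⟩ := hU.leading
  set F := noise μ A x + (expMatrix μ A - signal (community π₁ n) r w lam)
  have hdec : A x = signal (community π₁ n) r w lam + F := by
    simp only [F, noise]; abel
  have hF : ∀ z, vnorm (F *ᵥ z) ≤ τ / 2 * vnorm z := fun z => by
    rw [add_mulVec]
    refine (vnorm_add_le _ _).trans ?_
    have h1 := vnorm_le_of_dotProduct_le hσ (hE z)
    have h2 := h.vnorm_expMatrix_sub_signal_le hs z
    have h3 := mul_le_mul_of_nonneg_right hτ2 (vnorm_nonneg z)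
    linarith
  have hFb : ∀ f, vnorm (F *ᵥ blockVec (community π₁ n) f) ≤
      (√(8 * L / κ) + 1) * vnorm (blockVec (community π₁ n) f) := fun f => by
    rw [add_mulVec]
    refine (vnorm_add_le _ _).trans ?_
    have h1 := vnorm_noise_mulVec_blockVec_le hκ hn hL hc hEb f
    have h2 := h.vnorm_expMatrix_sub_signal_le hs (blockVec (community π₁ n) f)
    linarith
  have hbig : ∀ k, τ ≤ |ρ k| := by
    refine le_abs_eigenvalue (h.symm x) hU.orthonormal hρ hlead fun u => ?_
    obtain ⟨f, hf0, hf⟩ := exists_blockVec_orthogonal (community π₁ n)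
      (fun a => zero_lt_two.trans_le (hs a)) u
    refine ⟨_, hf0, hf, ?_⟩
    have h1 := le_vnorm_signal_mulVec (community π₁ n) (r := r) (w := w)
      (lam := lam) hκ hn hc f
    have h3 : signal (community π₁ n) r w lam *ᵥ blockVec (community π₁ n) f =
        A x *ᵥ blockVec (community π₁ n) f - F *ᵥ blockVec (community π₁ n) f := by
      rw [← sub_mulVec, hdec]; congr 1; abel
    rw [h3] at h1
    have h4 := h1.trans (vnorm_sub_le _ _)
    have h5 := hFb f
    have h6 := mul_le_mul_of_nonneg_right hτ1 (vnorm_nonneg (blockVec (community π₁ n) f))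
    linarith
  have := fun k => exists_blockVec_close (community π₁ n) hdec hτ (hbig k) hF
    (η := √(8 * L / κ) + 1) (by positivity) hFb
    (vnorm_eq_one (by rw [dotProduct_of_orthonormal hU.orthonormal, if_pos rfl])) (hρ k)
  choose f hf using this
  exact ⟨f, hf⟩

end IsSBM

theorem eventually_ten_div_le_rpow {δ : ℝ} (hδ : δ < 1) :
    ∀ᶠ n : ℕ in atTop, 10 / (n : ℝ) ≤ (n : ℝ) ^ (-δ) := by
  have h := (tendsto_rpow_atTop (sub_pos.2 hδ)).comp (tendsto_natCast_atTop_atTop (R := ℝ))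
  filter_upwards [h.eventually_ge_atTop 10, eventually_gt_atTop 0] with n h1 hn
  have hn' : (0 : ℝ) < n := by exact_mod_cast hn
  rw [div_le_iff₀ hn']
  calc (10 : ℝ) ≤ (n : ℝ) ^ (1 - δ) := h1
    _ = (n : ℝ) ^ (-δ) * n := by
      rw [sub_eq_neg_add, Real.rpow_add hn', Real.rpow_one]

end TwoBlock

/-! ### Choice of constants and the final union bound -/

theorem theorem6 (π₁ r w δ : ℝ) (hπ₀ : 0 < π₁) (hπ₁ : π₁ < 1) (hr : 0 ≤ r) (hw : 0 ≤ w)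
    (hrank : w ≠ r ^ 2) (hδ₀ : 0 < δ) (hδ₁ : δ < 1) :
    ∃ M : ℝ, 0 < M ∧ ∀ lam : ℕ → ℝ,
      (fun n : ℕ => Real.log (n : ℝ)) =O[atTop] lam →
      ∀ᶠ n : ℕ in atTop, ∀ (Ω : Type*) [MeasurableSpace Ω] (μ : Measure Ω)
        [IsProbabilityMeasure μ] (A : Ω → Matrix (Fin n) (Fin n) ℝ),
        TwoBlock.IsSBM μ π₁ r w (lam n) n A →
        1 - (n : ℝ) ^ (-δ) ≤ μ.real {x |
          (∀ Ubar U : Matrix (Fin 2) (Fin n) ℝ, ∀ e : Fin n → ℝ,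
            TwoBlock.IsLeadingPair (TwoBlock.expMatrix μ A) Ubar → TwoBlock.IsEstimate U e →
            1 / (n : ℝ) * TwoBlock.sqDist e (TwoBlock.trueLabel π₁ n) ≤ M * ‖U - Ubar‖ ^ 2 ∧
            (U * Uᵀ = 1 →
              1 / (n : ℝ) * TwoBlock.sqDist e (TwoBlock.trueLabel π₁ n) ≤
                M * ‖Uᵀ * U - Ubarᵀ * Ubar‖ ^ 2)) ∧
          (∀ U : Matrix (Fin 2) (Fin n) ℝ, ∀ e : Fin n → ℝ,
            TwoBlock.IsLeadingPair (A x) U → TwoBlock.IsEstimate U e →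
            TwoBlock.misFraction e (TwoBlock.trueLabel π₁ n) ≤ M / lam n)} := by
  set κ := min π₁ (1 - π₁) / 2 with hκdef
  have hκ : 0 < κ := half_pos (lt_min hπ₀ (by linarith))
  set b := max 1 (max r w) with hbdef
  have hb1 : 1 ≤ b := le_max_left _ _
  have hb : 0 < b := by linarith
  set C₁ := TwoBlock.signalConst κ r w
  have hC₁ : 0 < C₁ := TwoBlock.signalConst_pos hκ hrank
  set C₂ := √(8 * b / κ) + 1 with hC₂def
  have hC₂ : 0 < C₂ := by positivity
  set M₁ := 256 / κ ^ 2 + 1600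
  have hM₁ : 0 < M₁ := by positivity
  -- The first summand serves the deterministic claim. The second is a quarter of `M₁ * (6 * C₂ /
  -- C₁) ^ 2`: the eigenvector error is at most `6 * C₂ / (C₁ * √(lam n))`, and the quarter converts
  -- squared distance to a fraction of nodes.
  refine ⟨M₁ + 9 * M₁ * C₂ ^ 2 / C₁ ^ 2, by positivity, fun lam hlog => ?_⟩
  have hM₁M : M₁ ≤ M₁ + 9 * M₁ * C₂ ^ 2 / C₁ ^ 2 := le_add_of_nonneg_right (by positivity)
  obtain ⟨C, hC, hCb⟩ := hlog.exists_pos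
  -- The three summands ensure, in turn, `1 ≤ lam n`, `8 ≤ C₁ * lam n` and `C₂ * √(lam n) ≤ C₁ * lam
  -- n / 2`.
  set Λ := 1 + 8 / C₁ + (2 * C₂ / C₁) ^ 2 with hΛ
  have hlogt : Tendsto (fun n : ℕ => Real.log n) atTop atTop :=
    Real.tendsto_log_atTop.comp tendsto_natCast_atTop_atTop
  filter_upwards [hCb.bound, hlogt.eventually_ge_atTop (C * Λ), eventually_gt_atTop 0,
    TwoBlock.eventually_le_blockSize_community hπ₀ hπ₁, eventually_ge_atTop ⌈2 / κ⌉₊,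
    TwoBlock.eventually_measure_noise_norm_le (ε := C₁ / (8 * b)) (c := 1 / C) (by positivity)
      (by positivity), TwoBlock.eventually_ten_div_le_rpow hδ₁] with n hn1 hn2 hn hsize hn3 hnorm hn4
  intro Ω _ μ _ A h
  have hn' : (0 : ℝ) < n := by exact_mod_cast hn
  have hsize : ∀ a, κ * n ≤ TwoBlock.blockSize (TwoBlock.community π₁ n) a := hsize
  have hs : ∀ a, 2 ≤ TwoBlock.blockSize (TwoBlock.community π₁ n) a := fun a => by
    refine le_trans ?_ (hsize a)
    have := Nat.ceil_le.1 hn3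
    rw [div_le_iff₀ hκ] at this
    linarith
  have hlam0 : 0 ≤ lam n := h.lam_nonneg hn hs
  have hloglam : Real.log n ≤ C * lam n := by
    rw [Real.norm_eq_abs, Real.norm_eq_abs, abs_of_nonneg hlam0] at hn1
    exact (le_abs_self _).trans hn1
  have hΛlam : Λ ≤ lam n := le_of_mul_le_mul_left (hn2.trans hloglam) hC
  have h8 : 0 < 8 / C₁ := by positivity
  have hlam1 : 1 ≤ lam n := by
    refine le_trans ?_ hΛlam
    rw [hΛ]
    nlinarith [sq_nonneg (2 * C₂ / C₁)]
  have hlamC₁ : 8 ≤ C₁ * lam n := by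
    have : 8 / C₁ ≤ lam n := by
      refine le_trans ?_ hΛlam
      rw [hΛ]
      nlinarith [sq_nonneg (2 * C₂ / C₁)]
    rw [div_le_iff₀ hC₁] at this
    linarith
  have hsq : C₂ * √(lam n) ≤ C₁ * lam n / 2 := by
    have h1 : 2 * C₂ / C₁ ≤ √(lam n) := by
      refine Real.le_sqrt_of_sq_le (le_trans ?_ hΛlam)
      rw [hΛ]
      linarith
    rw [div_le_iff₀ hC₁] at h1
    have h2 := Real.mul_self_sqrt hlam0
    have h3 := mul_le_mul_of_nonneg_right h1 (Real.sqrt_nonneg (lam n))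
    nlinarith
  set L := lam n * b with hLdef
  have hL1 : 1 ≤ L := one_le_mul_of_one_le_of_one_le hlam1 hb1
  have hq1 : L / n ≤ 1 := h.maxProb_le_one hs
  have hq : ∀ i j, TwoBlock.expMatrix μ A i j ≤ L / n := h.expMatrix_le_maxProb hn hlam0
  have hη : √(8 * L / κ) + 1 ≤ C₂ * √(lam n) := by
    have e : √(8 * L / κ) = √(8 * b / κ) * √(lam n) := by
      rw [← Real.sqrt_mul (by positivity)]
      congr 1
      rw [hLdef]
      ring
    rw [e, hC₂def, add_mul, one_mul]
    have : 1 ≤ √(lam n) := Real.one_le_sqrt.2 hlam1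
    linarith
  have hP₁ := hnorm L (by
    rw [div_mul_eq_mul_div, one_mul, div_le_iff₀ hC, mul_comm L]
    exact hloglam.trans (mul_le_mul_of_nonneg_left (le_mul_of_one_le_right hlam0 hb1) hC.le)) hq1 Ω μ A π₁ r w (lam n) h hq
  have hP₂ := fun a => h.measure_noise_mulVec_sq_le hn hL1 hq1 hq
    (b := TwoBlock.blockVec (TwoBlock.community π₁ n) (Pi.single a 1)) fun i => by
      simp only [TwoBlock.blockVec, Pi.single_apply]
      split_ifs <;> simp
  set good := {x | (∀ Ubar U : Matrix (Fin 2) (Fin n) ℝ, ∀ e : Fin n → ℝ,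
      TwoBlock.IsLeadingPair (TwoBlock.expMatrix μ A) Ubar → TwoBlock.IsEstimate U e →
      1 / (n : ℝ) * TwoBlock.sqDist e (TwoBlock.trueLabel π₁ n) ≤
        (M₁ + 9 * M₁ * C₂ ^ 2 / C₁ ^ 2) * ‖U - Ubar‖ ^ 2 ∧
      (U * Uᵀ = 1 →
        1 / (n : ℝ) * TwoBlock.sqDist e (TwoBlock.trueLabel π₁ n) ≤
          (M₁ + 9 * M₁ * C₂ ^ 2 / C₁ ^ 2) * ‖Uᵀ * U - Ubarᵀ * Ubar‖ ^ 2)) ∧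
    (∀ U : Matrix (Fin 2) (Fin n) ℝ, ∀ e : Fin n → ℝ,
      TwoBlock.IsLeadingPair (A x) U → TwoBlock.IsEstimate U e →
      TwoBlock.misFraction e (TwoBlock.trueLabel π₁ n) ≤
        (M₁ + 9 * M₁ * C₂ ^ 2 / C₁ ^ 2) / lam n)} with hgood
  have hbad : goodᶜ ⊆ {x | ¬ ∀ z, (TwoBlock.noise μ A x *ᵥ z) ⬝ᵥ (TwoBlock.noise μ A x *ᵥ z) ≤
      (C₁ / (8 * b) * L) ^ 2 * (z ⬝ᵥ z)} ∪ ({x | ¬ (TwoBlock.noise μ A x *ᵥ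
        TwoBlock.blockVec (TwoBlock.community π₁ n) (Pi.single 0 1)) ⬝ᵥ (TwoBlock.noise μ A x *ᵥ
        TwoBlock.blockVec (TwoBlock.community π₁ n) (Pi.single 0 1)) ≤ 4 * n * L} ∪
      {x | ¬ (TwoBlock.noise μ A x *ᵥ
        TwoBlock.blockVec (TwoBlock.community π₁ n) (Pi.single 1 1)) ⬝ᵥ (TwoBlock.noise μ A x *ᵥ
        TwoBlock.blockVec (TwoBlock.community π₁ n) (Pi.single 1 1)) ≤ 4 * n * L}) := by
    intro x hx
    by_contra hnot
    simp only [Set.mem_union, Set.mem_ofPred_eq, not_or, not_not] at hnot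
    obtain ⟨hx1, hx2, hx3⟩ := hnot
    apply hx
    refine ⟨fun Ubar U e hUbar he => ?_, fun U e hU he => ?_⟩
    · obtain ⟨f, hf⟩ := h.exists_blockVec_of_isLeadingPair hn hs hκ hsize
        (show 2 < C₁ * lam n by linarith) hUbar
      refine ⟨?_, fun hU => ?_⟩
      · exact (TwoBlock.sqDist_le_norm_sub _ hκ hn hsize he hUbar.orthonormal f hf).trans
          (mul_le_mul_of_nonneg_right hM₁M (sq_nonneg _))
      · exact (TwoBlock.sqDist_le_norm_proj_sub _ hκ hn hsize he hU f hf).trans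
          (mul_le_mul_of_nonneg_right hM₁M (sq_nonneg _))
    · have hσ : C₁ / (8 * b) * L = C₁ * lam n / 8 := by
        rw [hLdef]
        field_simp
      obtain ⟨f, hf⟩ := h.exists_blockVec_close_of_isLeadingPair hn hs hκ (by linarith)
        (σ := C₁ / (8 * b) * L) (by positivity) hsize hx1
        (fun a => by
          rcases Fin.exists_fin_two.1 ⟨a, rfl⟩ with rfl | rfl <;> assumption)
        (τ := C₁ * lam n / 2) (by positivity)
        (show C₁ * lam n / 2 + (√(8 * L / κ) + 1) ≤ C₁ * lam n by linarith)
        (by rw [hσ]; linarith) hU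
      have h1 := TwoBlock.sqDist_le_of_orthonormal _ hκ hn hsize he hU.orthonormal f hf
      have h2 : 3 * (√(8 * L / κ) + 1) / (C₁ * lam n / 2) ≤
          3 * (C₂ * √(lam n)) / (C₁ * lam n / 2) := by gcongr
      have h3 : (3 * (√(8 * L / κ) + 1) / (C₁ * lam n / 2)) ^ 2 ≤
          36 * C₂ ^ 2 / C₁ ^ 2 / lam n := by
        refine (pow_le_pow_left₀ (by positivity) h2 2).trans (le_of_eq ?_)
        rw [div_pow, mul_pow, mul_pow, Real.sq_sqrt hlam0]
        field_simp
        norm_num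
      have h7 := TwoBlock.misFraction_eq (fun i => (he i).1)
        (TwoBlock.blockLabel_eq (TwoBlock.community π₁ n))
      have h4 := h1.trans (mul_le_mul_of_nonneg_left h3 hM₁.le)
      have h5 : 0 ≤ M₁ / lam n := by positivity
      have h6 : M₁ * (36 * C₂ ^ 2 / C₁ ^ 2 / lam n) = 4 * (9 * M₁ * C₂ ^ 2 / C₁ ^ 2 / lam n) := by
        ring
      rw [add_div]
      change TwoBlock.misFraction e (TwoBlock.blockLabel (TwoBlock.community π₁ n)) ≤ _
      rw [h7]
      linarith
  have hcompl : μ.real goodᶜ ≤ 10 / n := by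
    refine (measureReal_mono hbad).trans ((measureReal_union_le _ _).trans ?_)
    have h1 := measureReal_union_le (μ := μ) {x | ¬ (TwoBlock.noise μ A x *ᵥ
        TwoBlock.blockVec (TwoBlock.community π₁ n) (Pi.single 0 1)) ⬝ᵥ (TwoBlock.noise μ A x *ᵥ
        TwoBlock.blockVec (TwoBlock.community π₁ n) (Pi.single 0 1)) ≤ 4 * n * L}
      {x | ¬ (TwoBlock.noise μ A x *ᵥ
        TwoBlock.blockVec (TwoBlock.community π₁ n) (Pi.single 1 1)) ⬝ᵥ (TwoBlock.noise μ A x *ᵥ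
        TwoBlock.blockVec (TwoBlock.community π₁ n) (Pi.single 1 1)) ≤ 4 * n * L}
    have h2 := hP₂ 0
    have h3 := hP₂ 1
    have e : (10 : ℝ) / n = 2 / n + (4 / n + 4 / n) := by ring
    rw [e]
    linarith
  -- Subadditivity is enough here, so measurability of `good` is not required.
  have huniv : (1 : ℝ) ≤ μ.real good + μ.real goodᶜ := by
    rw [← probReal_univ (μ := μ), ← Set.union_compl_self good]
    exact measureReal_union_le _ _
  linarith
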